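/- Write $dz$ for Lebesgue measure on $\mathbb C$ and consider the following three models, each with a space $\Lambda$, an invariant Riemannian metric $\lambda(z)^2|dz|^2$ with area measure $d\nu=\lambda(z)^2\,dz$ on $\Lambda$, and, for each admissible density parameter $\rho$, a kernel $\check K_\rho$ and a reference measure $\mu_\rho$ on $\Lambda$. Planar: $\Lambda=\mathbb C$, $\lambda=1$, $\rho>0$ real, $\check K_\rho(z,w)=e^{\rho z\bar w}$, $d\mu_\rho(z)=\frac{\rho}{\pi}e^{-\rho|z|^2}dz$. Spherical: $\Lambda=\mathbb C\cup\{\infty\}$ in the stereographic coordinate $z\in\mathbb C$ (the $\nu$-null point $\infty$ is ignored), $\lambda(z)=(1+|z|^2)^{-1}$, $\rho\ge 1$ an integer, $\check K_\rho(z,w)=(1+z\bar w)^{\rho-1}$, $d\mu_\rho(z)=\frac{\rho}{\pi}(1+|z|^2)^{-(\rho+1)}dz$. Hyperbolic: $\Lambda=\{|z|<1\}$, $\lambda(z)=(1-|z|^2)^{-1}$, $\rho>0$ real, $\check K_\rho(z,w)=(1-z\bar w)^{-(\rho+1)}$ (principal branch), $d\mu_\rho(z)=\frac{\rho}{\pi}(1-|z|^2)^{\rho-1}dz$.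 A point process $\mathcal Z$ on $\Lambda$ (a random locally finite subset) is determinantal with kernel $K$ and reference measure $\mu$ if, for all $k\ge 1$ and all pairwise disjoint Borel sets $D_1,\dots,D_k$, $$\mathbf E\Big[\prod_{i=1}^k\#(D_i\cap\mathcal Z)\Big]=\int_{D_1\times\cdots\times D_k}\det\big(K(x_i,x_j)\big)_{1\le i,j\le k}\,d\mu(x_1)\cdots d\mu(x_k).$$ For a real function $f$ on $\Lambda$ with weak gradient $\nabla f$ in the coordinate $z$, the intrinsic gradient has length $|\nabla_\iota f|=|\nabla f|/\lambda$; write $f\in H^1(\nu)$ if $\int_\Lambda|\nabla_\iota f|^2\,d\nu<\infty$. Theorem (variance bound). There is a universal constant $c>0$ such that, for each of the three models, every admissible $\rho>1$, every determinantal process $\mathcal Z$ with kernel $\check K_\rho$ and reference measure $\mu_\rho$, and every $f\in H^1(\nu)\cap L^1(\nu)$, the sum $\sum_{z\in\mathcal Z}f(z)$ converges absolutely almost surely, has a finite second moment, and satisfies $$\operatorname{Var}\Big(\sum_{z\in\mathcal Z}f(z)\Big)\le c\int_\Lambda|\nabla_\iota f|^2\,d\nu .$$ -/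

import Mathlib

open MeasureTheory ProbabilityTheory
open scoped ENNReal ComplexConjugate

noncomputable section

/-- The three models. Each space is described in its complex coordinate `z`; for the sphere this is
the stereographic coordinate, and the point at infinity (a null set) is left out. -/
inductive InvModel where
  | planar
  | spherical
  | hyperbolic

namespace InvModel

/-- The range `Λ ⊆ ℂ` of the coordinate: the plane, the sphere without `∞`, the unit disk. -/
def space : InvModel → Set ℂ
  | planar => Set.univ
  | spherical => Set.univ
  | hyperbolic => Metric.ball 0 1

/-- The admissible densities: `ρ > 0`, and `ρ` a positive integer for the spherical model. -/
def Admissible : InvModel → ℝ → Prop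
  | planar, ρ => 0 < ρ
  | spherical, ρ => ∃ n : ℕ, 0 < n ∧ ρ = n
  | hyperbolic, ρ => 0 < ρ

/-- The kernel with respect to the reference measure `InvModel.refMeasure`. -/
def kernel : InvModel → ℝ → ℂ → ℂ → ℂ
  | planar, ρ, z, w => Complex.exp ((ρ : ℂ) * (z * conj w))
  | spherical, ρ, z, w => (1 + z * conj w) ^ ((ρ : ℂ) - 1)
  | hyperbolic, ρ, z, w => 1 / (1 - z * conj w) ^ ((ρ : ℂ) + 1)

/-- The Lebesgue density of the reference measure. -/
def refDensity : InvModel → ℝ → ℂ → ℝ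
  | planar, ρ, z => ρ / Real.pi * Real.exp (-ρ * ‖z‖ ^ 2)
  | spherical, ρ, z => ρ / Real.pi * (1 + ‖z‖ ^ 2) ^ (-(ρ + 1))
  | hyperbolic, ρ, z => ρ / Real.pi * (1 - ‖z‖ ^ 2) ^ (ρ - 1)

/-- The reference measure `μ_ρ` on `Λ`. -/
def refMeasure (m : InvModel) (ρ : ℝ) : Measure ℂ :=
  (volume.restrict m.space).withDensity fun z => ENNReal.ofReal (m.refDensity ρ z)

/-- The conformal factor `λ` of the invariant Riemannian metric `λ(z)² |dz|²`. -/
def conformalFactor : InvModel → ℂ → ℝ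
  | planar, _ => 1
  | spherical, z => 1 / (1 + ‖z‖ ^ 2)
  | hyperbolic, z => 1 / (1 - ‖z‖ ^ 2)

/-- The invariant measure `dν = λ(z)² dz` on `Λ`, the Riemannian area. -/
def invMeasure (m : InvModel) : Measure ℂ :=
  (volume.restrict m.space).withDensity fun z => ENNReal.ofReal (m.conformalFactor z ^ 2)

/-- `|∇_ι f(z)|²`, where `g` is the gradient of `f` in the coordinate: for the metric `λ² |dz|²` the
intrinsic gradient is the vector `λ⁻² g`, which has length `|g| / λ`. -/
def intrinsicGradSq (m : InvModel) (g : ℂ → ℂ) (z : ℂ) : ℝ :=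
  ‖g z‖ ^ 2 / m.conformalFactor z ^ 2

end InvModel

/-- `g` is the weak gradient of `f` on the open set `U ⊆ ℂ = ℝ²`. -/
structure HasWeakGradientOn (U : Set ℂ) (f : ℂ → ℝ) (g : ℂ → ℂ) : Prop where
  locallyIntegrable : LocallyIntegrableOn f U volume
  locallyIntegrable_grad : LocallyIntegrableOn g U volume
  integral_eq : ∀ φ : ℂ → ℝ, ContDiff ℝ (⊤ : ℕ∞) φ → HasCompactSupport φ → tsupport φ ⊆ U → ∀ v : ℂ,
    ∫ z in U, f z * fderiv ℝ φ z v = -∫ z in U, inner ℝ (g z) v * φ z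

/-- `Z` is a point process on the open set `U ⊆ ℂ`: a random locally finite subset of `U`. -/
structure IsPointProcess {Ω : Type*} [MeasurableSpace Ω] (U : Set ℂ) (Z : Ω → Set ℂ) : Prop where
  subset : ∀ ω, Z ω ⊆ U
  locallyFinite : ∀ ω, ∀ C : Set ℂ, IsCompact C → C ⊆ U → (C ∩ Z ω).Finite
  measurable_count : ∀ D : Set ℂ, MeasurableSet D →
    Measurable fun ω => ((D ∩ Z ω).encard : ℝ≥0∞)

/-- Under `P`, the point process `Z` on `U` is determinantal with kernel `K` and reference measure
`μ`. For a kernel of positive type, such as those above, the determinants are non-negative reals. -/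
structure IsDeterminantal {Ω : Type*} [MeasurableSpace Ω] (P : Measure Ω) (U : Set ℂ)
    (K : ℂ → ℂ → ℂ) (μ : Measure ℂ) (Z : Ω → Set ℂ) : Prop extends IsPointProcess U Z where
  jointIntensity : ∀ k : ℕ, 1 ≤ k → ∀ D : Fin k → Set ℂ, (∀ i, MeasurableSet (D i)) →
    Pairwise (fun i j => Disjoint (D i) (D j)) →
    ∫⁻ ω, ∏ i, ((D i ∩ Z ω).encard : ℝ≥0∞) ∂P =
      ∫⁻ x in Set.univ.pi D, ENNReal.ofReal (Matrix.of fun i j => K (x i) (x j)).det.re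
        ∂(Measure.pi fun _ : Fin k => μ)

/-- The linear statistic `∑_{z ∈ Z} f(z)`. -/
def linearStatistic {Ω : Type*} (Z : Ω → Set ℂ) (f : ℂ → ℝ) (ω : Ω) : ℝ :=
  ∑' z : Z ω, f z

end

/-! Let `m` be the intensity of the process and `κ` the measure on pairs obtained from the squared
modulus of the kernel and two copies of the reference measure. The kernel reproduces, so both
marginals of `κ` are `m`. Since the truncated pair correlation is `-κ`, the linear statistic of `f`
has variance `∫ f² dm - ∫ f(z) f(w) dκ = ½ ∫ (f(z) - f(w))² dκ`. This uses only one- and two-point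
intensities and is turned into an upper bound, without the `½`, in `HasPairLaw.evariance_le`.

The three models are the case `c = 0, 1, -1` of one geometry: the metric `(1 + c|z|²)⁻² |dz|²` with
isometries `mobius c z`. By `InvModel.kernel_mul_swap`, `κ` has density `(ρ/π)² h(‖mobius c (-z)
w‖)` with respect to `ν ⊗ ν`, where `h` is `InvModel.profile`; it depends only on the distance of
the two points.

It remains to bound the energy of `f` against an invariant kernel by its Dirichlet energy. Join `z`
to `mobius c z u` by the image of the radial segment from `0` to `u`, bound the increment of `f` by
the integral of its intrinsic gradient, and apply Cauchy–Schwarz along the path. For a fixed time on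
the path, a displacement of radial law averages every function to its `ν`-integral
(`lintegral_lintegral_mobius_smul`). The gradient therefore factors out, and the energy is at most
`∫ |∇f|²` times `∫ L(|u|)² h(|u|) dν(u)`, with `L` the length of the path
(`lintegral_sub_sq_mobius_le`). The last integral is at most `256π/ρ²`, which cancels the factor
`(ρ/π)²` up to `256/π`, uniformly in `ρ > 1`.

Weak gradients are handled by Euclidean mollification and Fatou. This fits the curved models because
the Dirichlet integral is conformally invariant in dimension two. In the disk the argument runs on
smaller concentric discs, which are geodesically convex. -/

open Set Filter Topology
open scoped Convolution

noncomputable section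

/-! ### Random sets as counting measures. -/

section CountingMeasure

variable {α : Type*} [MeasurableSpace α]

/-- The counting measure of a subset, as a sum of Dirac masses. -/
def diracSum (S : Set α) : Measure α :=
  Measure.sum fun z : S => Measure.dirac (z : α)

lemma lintegral_diracSum [MeasurableSingletonClass α] (S : Set α) (F : α → ℝ≥0∞) :
    ∫⁻ z, F z ∂(diracSum S) = ∑' z : S, F z := by
  simp [diracSum, lintegral_sum_measure]

lemma diracSum_apply [MeasurableSingletonClass α] (S : Set α) {D : Set α}
    (hD : MeasurableSet D) : diracSum S D = ((D ∩ S).encard : ℝ≥0∞) := by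
  rw [← lintegral_indicator_one hD, lintegral_diracSum]
  have h : ∀ z : S, D.indicator (1 : α → ℝ≥0∞) z = (Subtype.val ⁻¹' D : Set S).indicator 1 z :=
    fun z => rfl
  simp_rw [h]
  rw [← tsum_subtype]
  simp only [Pi.one_apply]
  rw [ENNReal.tsum_set_one, ← Subtype.val_injective.encard_image, Subtype.image_preimage_coe,
    inter_comm]

lemma ae_diracSum (S : Set α) [MeasurableSingletonClass α] (hS : S.Countable) :
    ∀ᵐ z ∂(diracSum S), z ∈ S := by
  have : Countable S := hS
  refine (Measure.ae_sum_iff' hS.measurableSet).2 fun z => ?_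
  rw [ae_dirac_eq]
  exact z.2

-- Each atom has mass one, so a point of the set meets the diagonal of the product exactly once.
-- This is where it matters that the process has no multiple points.
open scoped Classical in
lemma diracSum_prod_diagonal [MeasurableSingletonClass α] [MeasurableEq α] {S : Set α}
    (hS : S.Countable) {A B : Set α} (hA : MeasurableSet A) (hB : MeasurableSet B) :
    ((diracSum S).prod (diracSum S)) (A ×ˢ B ∩ diagonal α) = diracSum S (A ∩ B) := by
  have : Countable S := hS
  have : SFinite (diracSum S) := by unfold diracSum; infer_instance
  rw [Measure.prod_apply ((hA.prod hB).inter measurableSet_diagonal),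
    ← lintegral_indicator_one (hA.inter hB)]
  refine lintegral_congr_ae ?_
  filter_upwards [ae_diracSum S hS] with z hz
  have h1 : Prod.mk z ⁻¹' (A ×ˢ B ∩ diagonal α) = if z ∈ A ∩ B then {z} else ∅ := by
    ext w
    by_cases h : z ∈ A ∩ B
    · simp only [h, if_true, mem_preimage, mem_inter_iff, mem_prod, mem_diagonal_iff,
        mem_singleton_iff]
      exact ⟨fun h => h.2.symm, fun e => by subst e; exact ⟨⟨h.1, h.2⟩, rfl⟩⟩
    · simp only [h, if_false, mem_preimage, mem_inter_iff, mem_prod, mem_diagonal_iff,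
        mem_empty_iff_false, iff_false]
      rintro ⟨⟨ha, hb⟩, e⟩
      exact h ⟨ha, e ▸ hb⟩
  rw [h1]
  by_cases h : z ∈ A ∩ B
  · rw [if_pos h, diracSum_apply S (measurableSet_singleton z), indicator_of_mem h,
      inter_eq_left.2 (singleton_subset_iff.2 hz)]
    simp
  · rw [if_neg h, indicator_of_notMem h, measure_empty]

end CountingMeasure

/-! ### First and second moments from a pair law, for non-negative functions. -/

/-- `Z` is a random countable set whose intensity is `m` and whose truncated pair correlation is
`-κ`, where `κ` has both marginals equal to `m` and does not charge the diagonal. -/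
structure HasPairLaw {Ω α : Type*} [MeasurableSpace Ω] [MeasurableSpace α] (P : Measure Ω)
    (Z : Ω → Set α) (m : Measure α) (κ : Measure (α × α)) : Prop where
  countable : ∀ ω, (Z ω).Countable
  measurable_count : ∀ D, MeasurableSet D → Measurable fun ω => ((D ∩ Z ω).encard : ℝ≥0∞)
  intensity : ∀ D, MeasurableSet D → ∫⁻ ω, ((D ∩ Z ω).encard : ℝ≥0∞) ∂P = m D
  pair : ∀ A B, MeasurableSet A → MeasurableSet B → Disjoint A B →
    ∫⁻ ω, ((A ∩ Z ω).encard : ℝ≥0∞) * ((B ∩ Z ω).encard : ℝ≥0∞) ∂P + κ (A ×ˢ B) = m A * m B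
  fst_marginal : κ.map Prod.fst = m
  snd_marginal : κ.map Prod.snd = m
  diagonal_null : κ (diagonal α) = 0
  prod_diagonal_null : (m.prod m) (diagonal α) = 0

namespace HasPairLaw

variable {Ω α : Type*} [MeasurableSpace Ω] [MeasurableSpace α]
  {P : Measure Ω} {Z : Ω → Set α} {m : Measure α} {κ : Measure (α × α)}

variable [MeasurableSingletonClass α]

lemma measurable_diracSum (h : HasPairLaw P Z m κ) : Measurable fun ω => diracSum (Z ω) :=
  Measure.measurable_of_measurable_coe _ fun D hD => by
    simp_rw [diracSum_apply _ hD]; exact h.measurable_count D hD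

lemma measurable_diracSum_apply (h : HasPairLaw P Z m κ) {A : Set α} (hA : MeasurableSet A) :
    Measurable fun ω => diracSum (Z ω) A :=
  (Measure.measurable_coe hA).comp h.measurable_diracSum

/-- With the intensity written as a mixture of counting measures, Campbell's formula is integration
against a `bind`. -/
lemma bind_diracSum (h : HasPairLaw P Z m κ) : P.bind (fun ω => diracSum (Z ω)) = m := by
  ext D hD
  rw [Measure.bind_apply hD h.measurable_diracSum.aemeasurable]
  simp_rw [diracSum_apply _ hD]
  exact h.intensity D hD

lemma lintegral_sum (h : HasPairLaw P Z m κ) {F : α → ℝ≥0∞} (hF : Measurable F) :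
    ∫⁻ ω, ∫⁻ z, F z ∂(diracSum (Z ω)) ∂P = ∫⁻ z, F z ∂m := by
  rw [← h.bind_diracSum, Measure.lintegral_bind h.measurable_diracSum.aemeasurable
    hF.aemeasurable]

lemma measurable_lintegral (h : HasPairLaw P Z m κ) {F : α → ℝ≥0∞} (hF : Measurable F) :
    Measurable fun ω => ∫⁻ z, F z ∂(diracSum (Z ω)) :=
  (Measure.measurable_lintegral hF).comp h.measurable_diracSum

/-- The pair identity is given only for disjoint sets; here the diagonal is restored. Off the
diagonal, `A ×ˢ B` is an increasing limit of finite disjoint unions of rectangles with disjoint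
sides. On the diagonal `κ` and `m ⊗ m` vanish, while the squared counting measure leaves the number
of points in `A ∩ B`. The `κ` term is added on the left because the quantities may be infinite. -/
lemma lintegral_count_mul_count [MeasurableSpace.CountablySeparated α] [MeasurableEq α]
    [SFinite m]
    (h : HasPairLaw P Z m κ) {A B : Set α} (hA : MeasurableSet A) (hB : MeasurableSet B) :
    ∫⁻ ω, diracSum (Z ω) A * diracSum (Z ω) B ∂P + κ (A ×ˢ B) = m (A ∩ B) + m A * m B := by
  -- Points are coded by binary sequences. A cell of level `n` fixes the first `n` bits, so two
  -- distinct points are in different cells from some level on.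
  obtain ⟨c, hc, hci⟩ := MeasurableSpace.measurable_injection_nat_bool_of_countablySeparated α
  let cell : (n : ℕ) → (Fin n → Bool) → Set α := fun n s => {z | ∀ k : Fin n, c z k = s k}
  have hcell : ∀ n s, MeasurableSet (cell n s) := fun n s => by
    have : cell n s = ⋂ k : Fin n, {z | c z k = s k} := by ext; simp [cell]
    rw [this]
    exact MeasurableSet.iInter fun k => measurableSet_eq_fun ((measurable_pi_apply _).comp hc)
      measurable_const
  let R : (n : ℕ) → ((Fin n → Bool) × (Fin n → Bool)) → Set (α × α) := fun n s =>
    (A ∩ cell n s.1) ×ˢ (B ∩ cell n s.2)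
  let off : (n : ℕ) → Finset ((Fin n → Bool) × (Fin n → Bool)) := fun n =>
    Finset.univ.filter fun s => s.1 ≠ s.2
  let E : ℕ → Set (α × α) := fun n => A ×ˢ B ∩ {x | ∃ k : Fin n, c x.1 k ≠ c x.2 k}
  have hER : ∀ n, E n = ⋃ s ∈ off n, R n s := fun n => by
    ext x
    simp only [E, R, off, cell, mem_inter_iff, mem_prod, mem_ofPred_eq, mem_iUnion,
      Finset.mem_filter, Finset.mem_univ, true_and]
    constructor
    · rintro ⟨⟨ha, hb⟩, k, hk⟩
      exact ⟨(fun k => c x.1 k, fun k => c x.2 k), fun e => hk (congrFun e k),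
        ⟨ha, fun _ => rfl⟩, hb, fun _ => rfl⟩
    · rintro ⟨s, hs, ⟨ha, h1⟩, hb, h2⟩
      obtain ⟨k, hk⟩ := Function.ne_iff.1 hs
      exact ⟨⟨ha, hb⟩, k, by rwa [h1 k, h2 k]⟩
  have hRm : ∀ n s, MeasurableSet (R n s) := fun n s =>
    (hA.inter (hcell _ _)).prod (hB.inter (hcell _ _))
  have hRd : ∀ n, (off n : Set _).PairwiseDisjoint (R n) := fun n s _ t _ hst => by
    rw [Function.onFun, Set.disjoint_left]
    rintro x ⟨⟨_, h1⟩, _, h2⟩ ⟨⟨_, h3⟩, _, h4⟩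
    exact hst (Prod.ext (funext fun k => (h1 k).symm.trans (h3 k))
      (funext fun k => (h2 k).symm.trans (h4 k)))
  have hEsum : ∀ (M : Measure (α × α)) n, M (E n) = ∑ s ∈ off n, M (R n s) := fun M n => by
    rw [hER, measure_biUnion_finset (hRd n) fun s _ => hRm n s]
  have hEmono : Monotone E := fun n n' hn x hx =>
    ⟨hx.1, hx.2.elim fun k hk => ⟨Fin.castLE hn k, hk⟩⟩
  have hEU : ⋃ n, E n = A ×ˢ B \ diagonal α := by
    ext x
    simp only [E, mem_iUnion, mem_inter_iff, mem_ofPred_eq, Set.mem_sdiff, mem_diagonal_iff]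
    constructor
    · rintro ⟨n, hx, k, hk⟩
      exact ⟨hx, fun e => hk (by rw [e])⟩
    · rintro ⟨hx, hne⟩
      obtain ⟨k, hk⟩ := Function.ne_iff.1 (hci.ne hne)
      exact ⟨k + 1, hx, ⟨k, by simp⟩, hk⟩
  have hlim : ∀ M : Measure (α × α),
      Tendsto (fun n => M (E n)) atTop (𝓝 (M (A ×ˢ B \ diagonal α))) := fun M => by
    rw [← hEU]; exact tendsto_measure_iUnion_atTop hEmono
  have hsf : ∀ ω, SFinite (diracSum (Z ω)) := fun ω => by
    have : Countable (Z ω) := h.countable ω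
    unfold diracSum; infer_instance
  have hpairm : ∀ n s, Measurable fun ω =>
      ((diracSum (Z ω)).prod (diracSum (Z ω))) (R n s) := fun n s => by
    simp_rw [R, Measure.prod_prod]
    exact (h.measurable_diracSum_apply (hA.inter (hcell _ _))).mul
      (h.measurable_diracSum_apply (hB.inter (hcell _ _)))
  have hEm : ∀ n, Measurable fun ω => ((diracSum (Z ω)).prod (diracSum (Z ω))) (E n) :=
    fun n => by
      simp_rw [hEsum]
      exact Finset.measurable_fun_sum _ fun s _ => hpairm n s
  have hfin : ∀ n, ∫⁻ ω, ((diracSum (Z ω)).prod (diracSum (Z ω))) (E n) ∂P + κ (E n) =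
      (m.prod m) (E n) := fun n => by
    simp_rw [hEsum]
    rw [lintegral_finsetSum _ fun s _ => hpairm n s, ← Finset.sum_add_distrib]
    refine Finset.sum_congr rfl fun s hs => ?_
    simp_rw [R, Measure.prod_prod]
    have hdis : Disjoint (A ∩ cell n s.1) (B ∩ cell n s.2) := by
      rw [Set.disjoint_left]
      rintro z ⟨_, h1⟩ ⟨_, h2⟩
      exact (Finset.mem_filter.1 hs).2 (funext fun k => (h1 k).symm.trans (h2 k))
    rw [← h.pair _ _ (hA.inter (hcell _ _)) (hB.inter (hcell _ _)) hdis]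
    simp_rw [diracSum_apply _ (hA.inter (hcell _ _)), diracSum_apply _ (hB.inter (hcell _ _))]
  have hmain : ∫⁻ ω, ((diracSum (Z ω)).prod (diracSum (Z ω))) (A ×ˢ B \ diagonal α) ∂P +
      κ (A ×ˢ B \ diagonal α) = (m.prod m) (A ×ˢ B \ diagonal α) := by
    have h1 : Tendsto (fun n => ∫⁻ ω, ((diracSum (Z ω)).prod (diracSum (Z ω))) (E n) ∂P) atTop
        (𝓝 (∫⁻ ω, ((diracSum (Z ω)).prod (diracSum (Z ω))) (A ×ˢ B \ diagonal α) ∂P)) :=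
      lintegral_tendsto_of_tendsto_of_monotone (fun n => (hEm n).aemeasurable)
        (ae_of_all _ fun ω n n' hn => measure_mono (hEmono hn)) (ae_of_all _ fun ω => hlim _)
    exact tendsto_nhds_unique ((h1.add (hlim κ)).congr hfin) (hlim (m.prod m))
  rw [measure_sdiff_null h.diagonal_null, measure_sdiff_null h.prod_diagonal_null,
    Measure.prod_prod] at hmain
  rw [← hmain, ← add_assoc]
  congr 1
  have hAB := h.intensity _ (hA.inter hB)
  rw [← hAB, ← lintegral_add_left (h.measurable_count _ (hA.inter hB))]
  refine lintegral_congr fun ω => ?_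
  rw [← diracSum_apply _ (hA.inter hB), ← diracSum_prod_diagonal (h.countable ω) hA hB,
    ← Measure.prod_prod]
  exact (measure_inter_add_sdiff _ measurableSet_diagonal).symm

/-- The sets are replaced by functions one variable at a time. For fixed `B` the count identity is
an equality of measures in `A` and can be integrated against `F`; the result is an equality of
measures in `B` and can be integrated against `G`. -/
lemma lintegral_sum_mul_sum [MeasurableSpace.CountablySeparated α] [MeasurableEq α] [SFinite m]
    (h : HasPairLaw P Z m κ) {F G : α → ℝ≥0∞} (hF : Measurable F) (hG : Measurable G) :
    ∫⁻ ω, (∫⁻ z, F z ∂(diracSum (Z ω))) * (∫⁻ z, G z ∂(diracSum (Z ω))) ∂P +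
      ∫⁻ x, F x.1 * G x.2 ∂κ = ∫⁻ z, F z * G z ∂m + (∫⁻ z, F z ∂m) * ∫⁻ z, G z ∂m := by
  have hξ := h.measurable_diracSum
  have key1 : ∀ B, MeasurableSet B →
      (P.withDensity fun ω => diracSum (Z ω) B).bind (fun ω => diracSum (Z ω)) +
        (κ.restrict (Prod.snd ⁻¹' B)).map Prod.fst = m.restrict B + m B • m := fun B hB => by
    have hBm : Measurable fun ω => diracSum (Z ω) B  :=
      h.measurable_diracSum_apply hB
    ext A hA
    have e := h.lintegral_count_mul_count hA hB
    rw [Measure.add_apply, Measure.bind_apply hA hξ.aemeasurable,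
      lintegral_withDensity_eq_lintegral_mul _ hBm (h.measurable_diracSum_apply hA),
      Measure.map_apply measurable_fst hA, Measure.restrict_apply (measurable_fst hA),
      Measure.add_apply, Measure.restrict_apply hA, Measure.smul_apply, smul_eq_mul,
      mul_comm (m B), ← e]
    simp_rw [Pi.mul_apply, mul_comm]
    congr 2
  have hFm := h.measurable_lintegral hF
  have key2 : (P.withDensity fun ω => ∫⁻ z, F z ∂(diracSum (Z ω))).bind
        (fun ω => diracSum (Z ω)) +
        (κ.withDensity fun x => F x.1).map Prod.snd =
      m.withDensity F + (∫⁻ z, F z ∂m) • m := by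
    ext B hB
    have hBm : Measurable fun ω => diracSum (Z ω) B  :=
      h.measurable_diracSum_apply hB
    have e := congrArg (fun M : Measure α => ∫⁻ z, F z ∂M) (key1 B hB)
    simp only [lintegral_add_measure, lintegral_smul_measure] at e
    rw [Measure.lintegral_bind hξ.aemeasurable hF.aemeasurable,
      lintegral_withDensity_eq_lintegral_mul _ hBm hFm, lintegral_map hF measurable_fst] at e
    rw [Measure.add_apply, Measure.bind_apply hB hξ.aemeasurable,
      lintegral_withDensity_eq_lintegral_mul _ hFm hBm,
      Measure.map_apply measurable_snd hB, withDensity_apply _ (measurable_snd hB),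
      Measure.add_apply, withDensity_apply _ hB, Measure.smul_apply, smul_eq_mul,
      mul_comm _ (m B)]
    rw [smul_eq_mul] at e
    rw [← e]
    simp_rw [Pi.mul_apply, mul_comm]
  have e := congrArg (fun M : Measure α => ∫⁻ z, G z ∂M) key2
  simp only [lintegral_add_measure, lintegral_smul_measure] at e
  rw [Measure.lintegral_bind hξ.aemeasurable hG.aemeasurable,
    lintegral_withDensity_eq_lintegral_mul _ hFm (h.measurable_lintegral hG),
    lintegral_map hG measurable_snd,
    lintegral_withDensity_eq_lintegral_mul κ (f := fun x => F x.1) (by fun_prop)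
      (g := fun x => G x.2) (by fun_prop),
    lintegral_withDensity_eq_lintegral_mul _ hF hG] at e
  exact e

end HasPairLaw

/-! ### Variance of real linear statistics. -/

namespace HasPairLaw

variable {Ω α : Type*} [MeasurableSpace Ω] [MeasurableSpace α]
  {P : Measure Ω} {Z : Ω → Set α} {m : Measure α} {κ : Measure (α × α)}

lemma integral_eq_toReal (μ : Measure α) {a : α → ℝ} (ha : Measurable a) (ha0 : ∀ z, 0 ≤ a z) :
    ∫ z, a z ∂μ = (∫⁻ z, ENNReal.ofReal (a z) ∂μ).toReal :=
  integral_eq_lintegral_of_nonneg_ae (ae_of_all _ ha0) ha.aestronglyMeasurable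

lemma integral_sub_sub_sub {μ : Measure α} {p q r s : α → ℝ} (hp : Integrable p μ)
    (hq : Integrable q μ) (hr : Integrable r μ) (hs : Integrable s μ) :
    ∫ x, ((p x - q x) - (r x - s x)) ∂μ =
      (∫ x, p x ∂μ - ∫ x, q x ∂μ) - (∫ x, r x ∂μ - ∫ x, s x ∂μ) := by
  rw [← integral_sub hp hq, ← integral_sub hr hs]
  exact integral_sub (hp.sub hq) (hr.sub hs)

lemma integrable_fst (h : HasPairLaw P Z m κ) {f : α → ℝ} (hfi : Integrable f m) :
    Integrable (fun x : α × α => f x.1) κ := by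
  rw [← h.fst_marginal] at hfi
  exact hfi.comp_measurable measurable_fst

lemma integrable_snd (h : HasPairLaw P Z m κ) {f : α → ℝ} (hfi : Integrable f m) :
    Integrable (fun x : α × α => f x.2) κ := by
  rw [← h.snd_marginal] at hfi
  exact hfi.comp_measurable measurable_snd

lemma integrable_prod_mul (h : HasPairLaw P Z m κ) {f g : α → ℝ}
    (hfi : Integrable f m) (hg : Measurable g) {T : ℝ} (hgT : ∀ z, |g z| ≤ T) :
    Integrable (fun x : α × α => f x.1 * g x.2) κ :=
  (h.integrable_fst hfi).mul_bdd (hg.comp measurable_snd).aestronglyMeasurable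
    (ae_of_all _ fun x => hgT x.2)

variable [MeasurableSingletonClass α]

lemma ae_integrable (h : HasPairLaw P Z m κ) {f : α → ℝ} (hf : Measurable f)
    (hfi : Integrable f m) : ∀ᵐ ω ∂P, Integrable f (diracSum (Z ω)) := by
  have h1 : ∫⁻ ω, ∫⁻ z, ‖f z‖ₑ ∂(diracSum (Z ω)) ∂P ≠ ∞ := by
    rw [h.lintegral_sum hf.enorm]; exact hfi.2.ne
  filter_upwards [ae_lt_top (h.measurable_lintegral hf.enorm) h1] with ω hω
  exact ⟨hf.aestronglyMeasurable, hω⟩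

lemma lintegral_sum_ne_top (h : HasPairLaw P Z m κ) {a : α → ℝ} (ha : Measurable a)
    (ha0 : ∀ z, 0 ≤ a z) (hai : Integrable a m) :
    ∫⁻ ω, ∫⁻ z, ENNReal.ofReal (a z) ∂(diracSum (Z ω)) ∂P ≠ ∞ := by
  rw [h.lintegral_sum ha.ennreal_ofReal]
  exact ((hasFiniteIntegral_iff_ofReal (ae_of_all _ ha0)).1 hai.2).ne

lemma integrable_sum_of_nonneg (h : HasPairLaw P Z m κ) {a : α → ℝ} (ha : Measurable a)
    (ha0 : ∀ z, 0 ≤ a z) (hai : Integrable a m) :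
    Integrable (fun ω => ∫ z, a z ∂(diracSum (Z ω))) P := by
  simp_rw [integral_eq_toReal _ ha ha0]
  exact integrable_toReal_of_lintegral_ne_top
    (h.measurable_lintegral ha.ennreal_ofReal).aemeasurable (h.lintegral_sum_ne_top ha ha0 hai)

lemma integral_sum_of_nonneg (h : HasPairLaw P Z m κ) {a : α → ℝ} (ha : Measurable a)
    (ha0 : ∀ z, 0 ≤ a z) (hai : Integrable a m) :
    ∫ ω, ∫ z, a z ∂(diracSum (Z ω)) ∂P = ∫ z, a z ∂m := by
  simp_rw [integral_eq_toReal _ ha ha0]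
  rw [integral_toReal (h.measurable_lintegral ha.ennreal_ofReal).aemeasurable
    (ae_lt_top (h.measurable_lintegral ha.ennreal_ofReal) (h.lintegral_sum_ne_top ha ha0 hai)),
    h.lintegral_sum ha.ennreal_ofReal]

lemma sum_eq_sub (h : HasPairLaw P Z m κ) {f : α → ℝ} (hf : Measurable f)
    (hfi : Integrable f m) :
    (fun ω => ∫ z, f z ∂(diracSum (Z ω))) =ᵐ[P] fun ω =>
      (∫ z, max (f z) 0 ∂(diracSum (Z ω))) - ∫ z, max (-f z) 0 ∂(diracSum (Z ω)) := by
  filter_upwards [h.ae_integrable hf hfi] with ω hω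
  rw [← integral_sub hω.pos_part hω.neg_part]
  simp_rw [max_zero_sub_eq_self]

lemma integrable_sum (h : HasPairLaw P Z m κ) {f : α → ℝ} (hf : Measurable f)
    (hfi : Integrable f m) : Integrable (fun ω => ∫ z, f z ∂(diracSum (Z ω))) P :=
  ((h.integrable_sum_of_nonneg (hf.max measurable_const) (fun _ => le_max_right _ _)
    hfi.pos_part).sub (h.integrable_sum_of_nonneg (hf.neg.max measurable_const)
    (fun _ => le_max_right _ _) hfi.neg_part)).congr (h.sum_eq_sub hf hfi).symm

lemma integral_sum (h : HasPairLaw P Z m κ) {f : α → ℝ} (hf : Measurable f)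
    (hfi : Integrable f m) :
    ∫ ω, ∫ z, f z ∂(diracSum (Z ω)) ∂P = ∫ z, f z ∂m := by
  rw [integral_congr_ae (h.sum_eq_sub hf hfi),
    integral_sub (h.integrable_sum_of_nonneg (hf.max measurable_const)
      (fun _ => le_max_right _ _) hfi.pos_part) (h.integrable_sum_of_nonneg
      (a := fun z => max (-f z) 0) (hf.neg.max measurable_const) (fun _ => le_max_right _ _)
      hfi.neg_part),
    h.integral_sum_of_nonneg (hf.max measurable_const) (fun _ => le_max_right _ _) hfi.pos_part,
    h.integral_sum_of_nonneg (a := fun z => max (-f z) 0) (hf.neg.max measurable_const)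
      (fun _ => le_max_right _ _) hfi.neg_part, ← integral_sub hfi.pos_part hfi.neg_part]
  simp_rw [max_zero_sub_eq_self]

variable [MeasurableSpace.CountablySeparated α] [MeasurableEq α] [SFinite m]

/-- Boundedness of `b` makes `∫ a b dm` finite. The identity in `[0, ∞]` then bounds the mixed
moment, and every term can be read as a real number. -/
lemma integral_sum_mul_sum_of_nonneg (h : HasPairLaw P Z m κ) {a b : α → ℝ} {T : ℝ}
    (ha : Measurable a) (ha0 : ∀ z, 0 ≤ a z) (hai : Integrable a m)
    (hb : Measurable b) (hb0 : ∀ z, 0 ≤ b z) (hbi : Integrable b m) (hbT : ∀ z, |b z| ≤ T) :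
    Integrable (fun ω => (∫ z, a z ∂(diracSum (Z ω))) * ∫ z, b z ∂(diracSum (Z ω))) P ∧
    ∫ ω, (∫ z, a z ∂(diracSum (Z ω))) * (∫ z, b z ∂(diracSum (Z ω))) ∂P +
      ∫ x, a x.1 * b x.2 ∂κ = ∫ z, a z * b z ∂m + (∫ z, a z ∂m) * ∫ z, b z ∂m := by
  have e := h.lintegral_sum_mul_sum ha.ennreal_ofReal hb.ennreal_ofReal
  simp_rw [← ENNReal.ofReal_mul (ha0 _)] at e
  have hab : Integrable (fun z => a z * b z) m :=
    hai.mul_bdd hb.aestronglyMeasurable (ae_of_all _ hbT)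
  have hκ := h.integrable_prod_mul hai hb hbT
  have fin : ∀ {β : Type _} [MeasurableSpace β] {μ : Measure β} {c : β → ℝ},
      (∀ z, 0 ≤ c z) → Integrable c μ → ∫⁻ z, ENNReal.ofReal (c z) ∂μ ≠ ∞ :=
    fun hc hci => ((hasFiniteIntegral_iff_ofReal (ae_of_all _ hc)).1 hci.2).ne
  have fab := fin (fun z => mul_nonneg (ha0 z) (hb0 z)) hab
  have fa := fin ha0 hai
  have fb := fin hb0 hbi
  have fP : ∫⁻ ω, (∫⁻ z, ENNReal.ofReal (a z) ∂(diracSum (Z ω))) *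
      (∫⁻ z, ENNReal.ofReal (b z) ∂(diracSum (Z ω))) ∂P ≠ ∞ := by
    refine ne_top_of_le_ne_top (ENNReal.add_ne_top.2 ⟨fab, ENNReal.mul_ne_top fa fb⟩) ?_
    rw [← e]; exact le_self_add
  have hm : Measurable fun ω => (∫⁻ z, ENNReal.ofReal (a z) ∂(diracSum (Z ω))) *
      (∫⁻ z, ENNReal.ofReal (b z) ∂(diracSum (Z ω))) :=
    (h.measurable_lintegral ha.ennreal_ofReal).mul (h.measurable_lintegral hb.ennreal_ofReal)
  simp_rw [integral_eq_toReal _ ha ha0, integral_eq_toReal _ hb hb0, ← ENNReal.toReal_mul]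
  refine ⟨integrable_toReal_of_lintegral_ne_top hm.aemeasurable fP, ?_⟩
  rw [integral_toReal hm.aemeasurable (ae_lt_top hm fP),
    integral_eq_toReal _ (a := fun x : α × α => a x.1 * b x.2) (by fun_prop)
      (fun x => mul_nonneg (ha0 _) (hb0 _)),
    integral_eq_toReal _ (a := fun z => a z * b z) (by fun_prop)
      (fun z => mul_nonneg (ha0 _) (hb0 _)),
    ← ENNReal.toReal_add fP (fin (fun x : α × α => mul_nonneg (ha0 x.1) (hb0 x.2)) hκ),
    ← ENNReal.toReal_add fab (ENNReal.mul_ne_top fa fb), e]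

/-- Bilinear expansion in the positive and negative parts of `f`, with the non-negative case applied
to each of the four products. -/
lemma second_moment_of_bounded (h : HasPairLaw P Z m κ) {f : α → ℝ} {T : ℝ}
    (hf : Measurable f) (hfi : Integrable f m) (hfT : ∀ z, |f z| ≤ T) :
    Integrable (fun ω => (∫ z, f z ∂(diracSum (Z ω))) ^ 2) P ∧
    ∫ ω, (∫ z, f z ∂(diracSum (Z ω))) ^ 2 ∂P + ∫ x, f x.1 * f x.2 ∂κ =
      ∫ z, f z ^ 2 ∂m + (∫ z, f z ∂m) ^ 2 := by
  have key : ∀ a b : α → ℝ, (Measurable a ∧ (∀ z, 0 ≤ a z) ∧ Integrable a m ∧ ∀ z, |a z| ≤ T) →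
      (Measurable b ∧ (∀ z, 0 ≤ b z) ∧ Integrable b m ∧ ∀ z, |b z| ≤ T) →
      (fun ω => ∫ z, f z ∂(diracSum (Z ω))) =ᵐ[P] (fun ω =>
        (∫ z, a z ∂(diracSum (Z ω))) - ∫ z, b z ∂(diracSum (Z ω))) →
      (∀ z, f z = a z - b z) →
      Integrable (fun ω => (∫ z, f z ∂(diracSum (Z ω))) ^ 2) P ∧
      ∫ ω, (∫ z, f z ∂(diracSum (Z ω))) ^ 2 ∂P + ∫ x, f x.1 * f x.2 ∂κ =
        ∫ z, f z ^ 2 ∂m + (∫ z, f z ∂m) ^ 2 := by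
    rintro a b ⟨ha, ha0, hai, haT⟩ ⟨hb, hb0, hbi, hbT⟩ hX hfab
    obtain ⟨iaa, eaa⟩ := h.integral_sum_mul_sum_of_nonneg ha ha0 hai ha ha0 hai haT
    obtain ⟨iab, eab⟩ := h.integral_sum_mul_sum_of_nonneg ha ha0 hai hb hb0 hbi hbT
    obtain ⟨iba, eba⟩ := h.integral_sum_mul_sum_of_nonneg hb hb0 hbi ha ha0 hai haT
    obtain ⟨ibb, ebb⟩ := h.integral_sum_mul_sum_of_nonneg hb hb0 hbi hb hb0 hbi hbT
    have hX2 : (fun ω => (∫ z, f z ∂(diracSum (Z ω))) ^ 2) =ᵐ[P] (fun ω =>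
        ((∫ z, a z ∂(diracSum (Z ω))) * (∫ z, a z ∂(diracSum (Z ω))) -
          (∫ z, a z ∂(diracSum (Z ω))) * (∫ z, b z ∂(diracSum (Z ω)))) -
        ((∫ z, b z ∂(diracSum (Z ω))) * (∫ z, a z ∂(diracSum (Z ω))) -
          (∫ z, b z ∂(diracSum (Z ω))) * (∫ z, b z ∂(diracSum (Z ω))))) := by
      filter_upwards [hX] with ω hω
      rw [hω]; ring
    refine ⟨((iaa.sub iab).sub (iba.sub ibb)).congr hX2.symm, ?_⟩
    rw [integral_congr_ae hX2, integral_sub_sub_sub iaa iab iba ibb]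
    have kaa := h.integrable_prod_mul hai ha haT
    have kab := h.integrable_prod_mul hai hb hbT
    have kba := h.integrable_prod_mul hbi ha haT
    have kbb := h.integrable_prod_mul hbi hb hbT
    have hκ : ∫ x, f x.1 * f x.2 ∂κ = (∫ x, a x.1 * a x.2 ∂κ - ∫ x, a x.1 * b x.2 ∂κ) -
        (∫ x, b x.1 * a x.2 ∂κ - ∫ x, b x.1 * b x.2 ∂κ) := by
      rw [← integral_sub_sub_sub kaa kab kba kbb]
      refine integral_congr_ae (ae_of_all _ fun x => ?_)
      simp only [hfab]; ring
    have maa : Integrable (fun z => a z * a z) m :=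
      hai.mul_bdd ha.aestronglyMeasurable (ae_of_all _ haT)
    have mab : Integrable (fun z => a z * b z) m :=
      hai.mul_bdd hb.aestronglyMeasurable (ae_of_all _ hbT)
    have mba : Integrable (fun z => b z * a z) m :=
      hbi.mul_bdd ha.aestronglyMeasurable (ae_of_all _ haT)
    have mbb : Integrable (fun z => b z * b z) m :=
      hbi.mul_bdd hb.aestronglyMeasurable (ae_of_all _ hbT)
    have hm2 : ∫ z, f z ^ 2 ∂m = (∫ z, a z * a z ∂m - ∫ z, a z * b z ∂m) -
        (∫ z, b z * a z ∂m - ∫ z, b z * b z ∂m) := by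
      rw [← integral_sub_sub_sub maa mab mba mbb]
      refine integral_congr_ae (ae_of_all _ fun z => ?_)
      simp only [hfab]; ring
    have hm1 : ∫ z, f z ∂m = ∫ z, a z ∂m - ∫ z, b z ∂m := by
      rw [← integral_sub hai hbi]
      exact integral_congr_ae (ae_of_all _ hfab)
    rw [hκ, hm2, hm1]
    linear_combination eaa - eab - eba + ebb
  have hT : ∀ z, 0 ≤ T := fun z => (abs_nonneg _).trans (hfT z)
  refine key (fun z => max (f z) 0) (fun z => max (-f z) 0)
    ⟨hf.max measurable_const, fun _ => le_max_right _ _, hfi.pos_part, fun z => ?_⟩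
    ⟨hf.neg.max measurable_const, fun _ => le_max_right _ _, hfi.neg_part, fun z => ?_⟩
    (h.sum_eq_sub hf hfi) fun z => (max_zero_sub_eq_self _).symm
  · rw [abs_of_nonneg (le_max_right _ _)]
    exact max_le ((le_abs_self _).trans (hfT z)) (hT z)
  · rw [abs_of_nonneg (le_max_right _ _)]
    exact max_le ((neg_le_abs _).trans (hfT z)) (hT z)

/-- As both marginals of `κ` are `m`, expanding the square gives `2 ∫ f² dm - 2 ∫ f(z) f(w) dκ`,
which is exactly twice the variance. The factor two is given away. -/
lemma evariance_le_of_bounded [IsProbabilityMeasure P] (h : HasPairLaw P Z m κ) {f : α → ℝ}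
    {T : ℝ} (hf : Measurable f) (hfi : Integrable f m) (hfT : ∀ z, |f z| ≤ T) :
    evariance (fun ω => ∫ z, f z ∂(diracSum (Z ω))) P ≤
      ∫⁻ x, ‖f x.1 - f x.2‖ₑ ^ 2 ∂κ := by
  obtain ⟨i2, e2⟩ := h.second_moment_of_bounded hf hfi hfT
  have hX : MemLp (fun ω => ∫ z, f z ∂(diracSum (Z ω))) 2 P :=
    (memLp_two_iff_integrable_sq (h.integrable_sum hf hfi).1).2 i2
  have hf2 : Integrable (fun z => f z ^ 2) m := by
    simp_rw [sq]; exact hfi.mul_bdd hf.aestronglyMeasurable (ae_of_all _ hfT)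
  have i1 := h.integrable_fst hf2
  have i3 := h.integrable_snd hf2
  have i4 := h.integrable_prod_mul hfi hf hfT
  have hexp : ∀ x : α × α, (f x.1 - f x.2) ^ 2 =
      (f x.1 ^ 2 - f x.1 * f x.2) - (f x.1 * f x.2 - f x.2 ^ 2) := fun x => by ring
  have hint : Integrable (fun x : α × α => (f x.1 - f x.2) ^ 2) κ := by
    simp_rw [hexp]; exact (i1.sub i4).sub (i4.sub i3)
  have hval : ∫ x, (f x.1 - f x.2) ^ 2 ∂κ =
      2 * ∫ z, f z ^ 2 ∂m - 2 * ∫ x, f x.1 * f x.2 ∂κ := by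
    simp_rw [hexp]
    rw [integral_sub_sub_sub i1 i4 i4 i3]
    have e1 : ∫ x, f x.1 ^ 2 ∂κ = ∫ z, f z ^ 2 ∂m := by
      rw [← h.fst_marginal, integral_map measurable_fst.aemeasurable
        (hf.pow_const 2).aestronglyMeasurable]
    have e3 : ∫ x, f x.2 ^ 2 ∂κ = ∫ z, f z ^ 2 ∂m := by
      rw [← h.snd_marginal, integral_map measurable_snd.aemeasurable
        (hf.pow_const 2).aestronglyMeasurable]
    rw [e1, e3]; ring
  have hnn : 0 ≤ ∫ x, (f x.1 - f x.2) ^ 2 ∂κ := integral_nonneg fun x => sq_nonneg _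
  have hR : ∫⁻ x, ‖f x.1 - f x.2‖ₑ ^ 2 ∂κ =
      ENNReal.ofReal (∫ x, (f x.1 - f x.2) ^ 2 ∂κ) := by
    rw [ofReal_integral_eq_lintegral_ofReal hint (ae_of_all _ fun x => sq_nonneg _)]
    refine lintegral_congr fun x => ?_
    rw [Real.enorm_eq_ofReal_abs, ← ENNReal.ofReal_pow (abs_nonneg _), sq_abs]
  rw [← ofReal_variance hX, hR]
  refine ENNReal.ofReal_le_ofReal ?_
  rw [variance_eq_sub hX]
  simp only [Pi.pow_apply]
  rw [h.integral_sum hf hfi]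
  linarith

/-- Truncation at `±n` is 1-Lipschitz and so does not raise the energy. The centred statistics of
the truncations converge almost surely, and Fatou passes the bound to `f`. -/
lemma evariance_le [IsProbabilityMeasure P] (h : HasPairLaw P Z m κ) {f : α → ℝ}
    (hf : Measurable f) (hfi : Integrable f m) :
    evariance (fun ω => ∫ z, f z ∂(diracSum (Z ω))) P ≤
      ∫⁻ x, ‖f x.1 - f x.2‖ₑ ^ 2 ∂κ := by
  let t : ℕ → α → ℝ := fun n z => max (-n) (min n (f z))
  have htm : ∀ n, Measurable (t n) := fun n => by fun_prop
  have htle : ∀ n z, |t n z| ≤ |f z| := fun n z => by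
    have hn : (0 : ℝ) ≤ n := n.cast_nonneg
    simp only [t, abs_le]
    rcases abs_cases (f z) with ⟨e, h0⟩ | ⟨e, h0⟩ <;> rw [e] <;> constructor
    · exact (by linarith : -f z ≤ 0).trans (le_max_of_le_right (le_min hn h0))
    · exact max_le (by linarith) (min_le_right _ _)
    · rw [neg_neg]; exact le_max_of_le_right (le_min (by linarith) le_rfl)
    · exact max_le (by linarith) ((min_le_right _ _).trans (by linarith))
  have htn : ∀ n z, |t n z| ≤ n := fun n z => by
    have hn : (0 : ℝ) ≤ n := n.cast_nonneg
    exact abs_le.2 ⟨le_max_left _ _, max_le (by linarith) (min_le_left _ _)⟩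
  have htlim : ∀ z, Tendsto (fun n => t n z) atTop (𝓝 (f z)) := fun z => by
    refine tendsto_const_nhds.congr' ?_
    obtain ⟨N, hN⟩ := exists_nat_ge |f z|
    filter_upwards [eventually_ge_atTop N] with n hn
    have hn' : |f z| ≤ n := hN.trans (by exact_mod_cast hn)
    rw [abs_le] at hn'
    simp only [t]
    rw [min_eq_right hn'.2, max_eq_right hn'.1]
  have hti : ∀ n, Integrable (t n) m := fun n =>
    hfi.mono (htm n).aestronglyMeasurable (ae_of_all _ fun z => htle n z)
  have hEt : Tendsto (fun n => ∫ ω, ∫ z, t n z ∂(diracSum (Z ω)) ∂P) atTop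
      (𝓝 (∫ ω, ∫ z, f z ∂(diracSum (Z ω)) ∂P)) := by
    simp_rw [h.integral_sum hf hfi, fun n => h.integral_sum (htm n) (hti n)]
    exact tendsto_integral_of_dominated_convergence (fun z => |f z|)
      (fun n => (htm n).aestronglyMeasurable) hfi.abs
      (fun n => ae_of_all _ fun z => htle n z) (ae_of_all _ htlim)
  have hXt : ∀ᵐ ω ∂P, Tendsto (fun n => ∫ z, t n z ∂(diracSum (Z ω))) atTop
      (𝓝 (∫ z, f z ∂(diracSum (Z ω)))) := by
    filter_upwards [h.ae_integrable hf hfi] with ω hω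
    exact tendsto_integral_of_dominated_convergence (fun z => |f z|)
      (fun n => (htm n).aestronglyMeasurable) hω.abs
      (fun n => ae_of_all _ fun z => htle n z) (ae_of_all _ htlim)
  have hbd : ∀ n, evariance (fun ω => ∫ z, t n z ∂(diracSum (Z ω))) P ≤
      ∫⁻ x, ‖f x.1 - f x.2‖ₑ ^ 2 ∂κ := fun n => by
    refine (h.evariance_le_of_bounded (htm n) (hti n) (htn n)).trans
      (lintegral_mono fun x => ?_)
    gcongr
    rw [Real.enorm_eq_ofReal_abs, Real.enorm_eq_ofReal_abs]
    refine ENNReal.ofReal_le_ofReal ((abs_max_sub_max_le_max _ _ _ _).trans ?_)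
    rw [sub_self, abs_zero, max_eq_right (abs_nonneg _)]
    refine (abs_min_sub_min_le_max _ _ _ _).trans ?_
    rw [sub_self, abs_zero, max_eq_right (abs_nonneg _)]
  calc evariance (fun ω => ∫ z, f z ∂(diracSum (Z ω))) P
      ≤ ∫⁻ ω, liminf (fun n => ‖∫ z, t n z ∂(diracSum (Z ω)) -
          ∫ ω, ∫ z, t n z ∂(diracSum (Z ω)) ∂P‖ₑ ^ 2) atTop ∂P := by
        refine lintegral_mono_ae ?_
        filter_upwards [hXt] with ω hω
        rw [(((hω.sub hEt).enorm).ennrpow_const 2 |>.congr fun n => by norm_num).liminf_eq]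
        norm_num
    _ ≤ liminf (fun n => evariance (fun ω => ∫ z, t n z ∂(diracSum (Z ω))) P) atTop := by
        refine lintegral_liminf_le' fun n => ?_
        exact (((h.integrable_sum (htm n) (hti n)).1.aemeasurable.sub_const _).enorm).pow_const 2
    _ ≤ _ := liminf_le_of_le (by isBoundedDefault) fun b hb => by
        obtain ⟨n, hn⟩ := hb.exists
        exact hn.trans (hbd n)

/-- The linear statistic of a random set with a pair law, for an integrable function. -/
theorem linearStatistic_bound {Z : Ω → Set ℂ} {m : Measure ℂ} {κ : Measure (ℂ × ℂ)} [SFinite m]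
    [IsProbabilityMeasure P] (h : HasPairLaw P Z m κ) {f : ℂ → ℝ} (hfi : Integrable f m)
    (hκ : ∫⁻ x, ‖f x.1 - f x.2‖ₑ ^ 2 ∂κ ≠ ∞) :
    (∀ᵐ ω ∂P, Summable fun z : Z ω => f z) ∧ MemLp (linearStatistic Z f) 2 P ∧
      evariance (linearStatistic Z f) P ≤ ∫⁻ x, ‖f x.1 - f x.2‖ₑ ^ 2 ∂κ := by
  obtain ⟨f', hf', hff⟩ := hfi.1.aemeasurable
  have hfi' : Integrable f' m := hfi.congr hff
  -- A set that is null for the intensity almost surely contains no point of the process, so passing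
  -- to a measurable representative changes no summand.
  have hZ : ∀ᵐ ω ∂P, ∀ z : Z ω, f z = f' z := by
    obtain ⟨N, hNsub, hN, hN0⟩ := exists_measurable_superset_of_null hff
    have h0 := h.intensity N hN
    rw [hN0, lintegral_eq_zero_iff (h.measurable_count N hN)] at h0
    filter_upwards [h0] with ω hω z
    by_contra hne
    have hz : (z : ℂ) ∈ N ∩ Z ω := ⟨hNsub hne, z.2⟩
    have : (N ∩ Z ω).encard = 0 := by simpa using hω
    rw [encard_eq_zero] at this
    exact (this ▸ hz : (z : ℂ) ∈ (∅ : Set ℂ))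
  have hκ' : ∫⁻ x, ‖f x.1 - f x.2‖ₑ ^ 2 ∂κ = ∫⁻ x, ‖f' x.1 - f' x.2‖ₑ ^ 2 ∂κ := by
    have e1 : ∀ᵐ x ∂κ, f x.1 = f' x.1 := by
      rw [← h.fst_marginal] at hff; exact ae_of_ae_map measurable_fst.aemeasurable hff
    have e2 : ∀ᵐ x ∂κ, f x.2 = f' x.2 := by
      rw [← h.snd_marginal] at hff; exact ae_of_ae_map measurable_snd.aemeasurable hff
    refine lintegral_congr_ae ?_
    filter_upwards [e1, e2] with x h1 h2
    rw [h1, h2]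
  have hsum : ∀ᵐ ω ∂P, HasSum (fun z : Z ω => f z) (∫ z, f' z ∂(diracSum (Z ω))) := by
    filter_upwards [hZ, h.ae_integrable hf' hfi'] with ω h1 h2
    simp_rw [h1]
    simpa [diracSum] using hasSum_integral_measure (f := f')
      (μ := fun z : Z ω => Measure.dirac (z : ℂ)) h2
  have hL : linearStatistic Z f =ᵐ[P] fun ω => ∫ z, f' z ∂(diracSum (Z ω)) := by
    filter_upwards [hsum] with ω hω using hω.tsum_eq
  have hev := h.evariance_le hf' hfi'
  have hev' : evariance (linearStatistic Z f) P ≤ ∫⁻ x, ‖f x.1 - f x.2‖ₑ ^ 2 ∂κ := by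
    rw [evariance_congr hL, hκ']; exact hev
  refine ⟨hsum.mono fun ω hω => hω.summable, ?_, hev'⟩
  have haes : AEStronglyMeasurable (linearStatistic Z f) P :=
    (h.integrable_sum hf' hfi').1.congr hL.symm
  exact (evariance_lt_top_iff_memLp haes).1 (hev'.trans_lt hκ.lt_top)

end HasPairLaw

/-! ### Surfaces of constant curvature and their Möbius isometries. -/

/-- The coordinate domain of the model surface of constant curvature `4c`. -/
def curvSpace (c : ℝ) : Set ℂ := {z | 0 < 1 + c * ‖z‖ ^ 2}

/-- The area measure of the metric `(1 + c|z|²)⁻² |dz|²`. -/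
def curvArea (c : ℝ) : Measure ℂ :=
  (volume.restrict (curvSpace c)).withDensity fun z =>
    ENNReal.ofReal ((1 / (1 + c * ‖z‖ ^ 2)) ^ 2)

/-- The Möbius translation taking `0` to `z`. -/
def mobius (c : ℝ) (z u : ℂ) : ℂ := (z + u) / (1 - c * conj z * u)

lemma mem_curvSpace {c : ℝ} {z : ℂ} : z ∈ curvSpace c ↔ 0 < 1 + c * ‖z‖ ^ 2 := Iff.rfl

lemma isOpen_curvSpace (c : ℝ) : IsOpen (curvSpace c) :=
  isOpen_lt continuous_const (by fun_prop)

lemma neg_mem_curvSpace {c : ℝ} {z : ℂ} (hz : z ∈ curvSpace c) : -z ∈ curvSpace c := by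
  simpa [curvSpace] using hz

lemma measurable_conformal (c : ℝ) :
    Measurable fun z : ℂ => ENNReal.ofReal ((1 / (1 + c * ‖z‖ ^ 2)) ^ 2) := by fun_prop

lemma measurable_mobius (c : ℝ) : Measurable fun x : ℂ × ℂ => mobius c x.1 x.2 := by
  have : Measurable fun x : ℂ × ℂ => (1 - c * conj x.1 * x.2 : ℂ) :=
    (by fun_prop : Continuous fun x : ℂ × ℂ => (1 - c * conj x.1 * x.2 : ℂ)).measurable
  exact (measurable_fst.add measurable_snd).div this

lemma lintegral_curvArea (c : ℝ) (F : ℂ → ℝ≥0∞) :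
    ∫⁻ z, F z ∂(curvArea c) =
      ∫⁻ z in curvSpace c, ENNReal.ofReal ((1 / (1 + c * ‖z‖ ^ 2)) ^ 2) * F z :=
  lintegral_withDensity_eq_lintegral_mul_non_measurable _ (measurable_conformal c)
    (ae_of_all _ fun _ => ENNReal.ofReal_lt_top) F

instance (c : ℝ) : SigmaFinite (curvArea c) := by
  unfold curvArea; exact SigmaFinite.withDensity_ofReal _

lemma curvArea_absolutelyContinuous (c : ℝ) : curvArea c ≪ volume :=
  (withDensity_absolutelyContinuous _ _).trans Measure.absolutelyContinuous_restrict

lemma ae_mem_curvSpace (c : ℝ) : ∀ᵐ z ∂(curvArea c), z ∈ curvSpace c :=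
  (withDensity_absolutelyContinuous _ _).ae_le
    (ae_restrict_mem (isOpen_curvSpace c).measurableSet)

/-- Divided by `‖1 - c z̄ u‖²`, this polynomial identity is the transformation rule of the conformal
factor. The invariance of the domain and of the metric follows from it, as does that of the squared
kernel in the curved models. -/
lemma norm_sq_mobius_identity (c : ℝ) (z u : ℂ) :
    ‖1 - c * conj z * u‖ ^ 2 + c * ‖z + u‖ ^ 2 = (1 + c * ‖z‖ ^ 2) * (1 + c * ‖u‖ ^ 2) := by
  simp only [Complex.sq_norm, Complex.normSq_apply, Complex.sub_re, Complex.sub_im,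
    Complex.mul_re, Complex.mul_im, Complex.conj_re, Complex.conj_im, Complex.ofReal_re,
    Complex.ofReal_im, Complex.one_re, Complex.one_im, Complex.add_re, Complex.add_im]
  ring

lemma one_add_norm_sq_mobius {c : ℝ} {z u : ℂ} (h : 1 - c * conj z * u ≠ 0) :
    1 + c * ‖mobius c z u‖ ^ 2 =
      (1 + c * ‖z‖ ^ 2) * (1 + c * ‖u‖ ^ 2) / ‖1 - c * conj z * u‖ ^ 2 := by
  have h' : ‖1 - c * conj z * u‖ ^ 2 ≠ 0 := pow_ne_zero _ (norm_ne_zero_iff.2 h)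
  rw [← norm_sq_mobius_identity, mobius, norm_div, div_pow, add_div, div_self h', mul_div_assoc]

lemma mobius_mem_curvSpace {c : ℝ} {z u : ℂ} (h : 1 - c * conj z * u ≠ 0)
    (hz : z ∈ curvSpace c) (hu : u ∈ curvSpace c) : mobius c z u ∈ curvSpace c := by
  rw [mem_curvSpace, one_add_norm_sq_mobius h]
  exact div_pos (mul_pos hz hu) (pow_pos (norm_pos_iff.2 h) 2)

lemma conj_mul_self_ofReal (z : ℂ) : conj z * z = ((‖z‖ ^ 2 : ℝ) : ℂ) := by
  rw [Complex.conj_mul']; push_cast; rfl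

lemma one_add_conj_mul_mobius {c : ℝ} {z u : ℂ} (h : 1 - c * conj z * u ≠ 0) :
    1 - c * conj (-z) * mobius c z u =
      ((1 + c * ‖z‖ ^ 2 : ℝ) : ℂ) / (1 - c * conj z * u) := by
  have e := conj_mul_self_ofReal z
  rw [mobius, eq_div_iff h, map_neg]
  field_simp
  push_cast at e ⊢
  linear_combination (c : ℂ) * e

lemma mobius_neg_mobius {c : ℝ} {z u : ℂ} (h : 1 - c * conj z * u ≠ 0) (hz : z ∈ curvSpace c) :
    mobius c (-z) (mobius c z u) = u := by
  have e := conj_mul_self_ofReal z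
  have hz' : ((1 + c * ‖z‖ ^ 2 : ℝ) : ℂ) ≠ 0 := Complex.ofReal_ne_zero.2 (ne_of_gt hz)
  have hm : mobius c z u * (1 - c * conj z * u) = z + u := div_mul_cancel₀ _ h
  rw [mobius, one_add_conj_mul_mobius h, div_div_eq_mul_div, div_eq_iff hz']
  push_cast at e ⊢
  linear_combination hm + (c * u : ℂ) * e

/-- The numerators differ by a sign and the denominators are conjugate. This is the symmetry of the
distance, by which a displacement seen from one end can be seen from the other. -/
lemma norm_mobius_neg_comm (c : ℝ) (z w : ℂ) : ‖mobius c (-z) w‖ = ‖mobius c (-w) z‖ := by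
  rw [mobius, mobius, norm_div, norm_div]
  congr 1
  · rw [← norm_neg]; congr 1; ring
  · rw [← Complex.norm_conj]; congr 1; simp; ring

lemma hasDerivAt_mobius {c : ℝ} {z u : ℂ} (h : 1 - c * conj z * u ≠ 0) :
    HasDerivAt (mobius c z) (((1 + c * ‖z‖ ^ 2 : ℝ) : ℂ) / (1 - c * conj z * u) ^ 2) u := by
  have e := conj_mul_self_ofReal z
  have h1 : HasDerivAt (fun u : ℂ => z + u) 1 u := (hasDerivAt_id u).const_add z
  have h2 : HasDerivAt (fun u : ℂ => 1 - c * conj z * u) (-(c * conj z)) u := by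
    simpa using ((hasDerivAt_id u).const_mul (c * conj z : ℂ)).const_sub 1
  refine (h1.div h2 h).congr_deriv ?_
  congr 1
  push_cast at e ⊢
  linear_combination (c : ℂ) * e

/-- The infinitesimal form of the isometry property. No assumption on `u` is needed beyond the
denominator: if `1 + c‖u‖² = 0`, both sides are zero by the convention for division. -/
lemma norm_deriv_mobius_mul {c : ℝ} {z u : ℂ} (h : 1 - c * conj z * u ≠ 0)
    (hz : z ∈ curvSpace c) :
    ‖((1 + c * ‖z‖ ^ 2 : ℝ) : ℂ) / (1 - c * conj z * u) ^ 2‖ *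
      (1 / (1 + c * ‖mobius c z u‖ ^ 2)) = 1 / (1 + c * ‖u‖ ^ 2) := by
  have hz' : 0 < 1 + c * ‖z‖ ^ 2 := hz
  have h' : ‖1 - c * conj z * u‖ ≠ 0 := norm_ne_zero_iff.2 h
  rw [one_add_norm_sq_mobius h, norm_div, norm_pow, Complex.norm_real, Real.norm_of_nonneg hz'.le,
    one_div_div]
  by_cases hu : 1 + c * ‖u‖ ^ 2 = 0
  · simp [hu]
  · field_simp

lemma ae_mobius_den_ne_zero (c : ℝ) (z : ℂ) : ∀ᵐ u : ℂ, 1 - c * conj z * u ≠ 0 := by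
  have : {u : ℂ | ¬ (1 - c * conj z * u ≠ 0)}.Subsingleton := by
    intro u hu v hv
    simp only [mem_ofPred_eq, not_not] at hu hv
    have h0 : (c * conj z : ℂ) ≠ 0 := fun h0 => by simp [h0] at hu
    exact mul_left_cancel₀ h0 (by linear_combination hv - hu)
  exact this.measure_zero volume

lemma abs_det_toSpanSingleton (a : ℂ) :
    |(ContinuousLinearMap.restrictScalars ℝ
      (ContinuousLinearMap.toSpanSingleton ℂ a)).det| = ‖a‖ ^ 2 := by
  have h : LinearMap.det ((LinearMap.restrictScalars ℝ
      ((ContinuousLinearMap.toSpanSingleton ℂ a : ℂ →L[ℂ] ℂ) : ℂ →ₗ[ℂ] ℂ))) =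
      Complex.normSq a := by
    rw [LinearMap.det_restrictScalars, Algebra.norm_complex_eq]
    simp
  rw [← Complex.normSq_eq_norm_sq, ← abs_of_nonneg (Complex.normSq_nonneg a), ← h]
  rfl

/-- Möbius translations preserve the area measure. -/
lemma lintegral_comp_mobius {c : ℝ} {z : ℂ} (hz : z ∈ curvSpace c) (F : ℂ → ℝ≥0∞) :
    ∫⁻ u, F (mobius c z u) ∂(curvArea c) = ∫⁻ w, F w ∂(curvArea c) := by
  have good : ∀ z : ℂ, MeasurableSet (curvSpace c ∩ {u : ℂ | 1 - c * conj z * u ≠ 0}) := fun z =>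
    (isOpen_curvSpace c).measurableSet.inter
      (isOpen_ne_fun (by fun_prop) continuous_const).measurableSet
  have hres : ∀ z : ℂ, (volume.restrict (curvSpace c) : Measure ℂ) =
      volume.restrict (curvSpace c ∩ {u : ℂ | 1 - c * conj z * u ≠ 0}) := fun z => by
    refine Measure.restrict_congr_set ?_
    filter_upwards [ae_mobius_den_ne_zero c z] with u hu
    exact propext ⟨fun h => ⟨h, hu⟩, fun h => h.1⟩
  -- Once its pole is removed, the translation is a bijection onto the domain without the pole of
  -- the inverse translation. Both poles are null.
  have himg : mobius c z '' (curvSpace c ∩ {u : ℂ | 1 - c * conj z * u ≠ 0}) =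
      curvSpace c ∩ {u : ℂ | 1 - c * conj (-z) * u ≠ 0} := by
    have hz' : ((1 + c * ‖z‖ ^ 2 : ℝ) : ℂ) ≠ 0 := Complex.ofReal_ne_zero.2 (ne_of_gt hz)
    ext w
    constructor
    · rintro ⟨u, ⟨hu, hd⟩, rfl⟩
      refine ⟨mobius_mem_curvSpace hd hz hu, ?_⟩
      simp only [mem_ofPred_eq]
      rw [one_add_conj_mul_mobius hd]
      exact div_ne_zero hz' hd
    · rintro ⟨hw, hd⟩
      refine ⟨mobius c (-z) w, ⟨mobius_mem_curvSpace hd (neg_mem_curvSpace hz) hw, ?_⟩, ?_⟩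
      · have := one_add_conj_mul_mobius hd
        rw [neg_neg, norm_neg] at this
        simp only [mem_ofPred_eq]
        rw [this]
        exact div_ne_zero hz' hd
      · have := mobius_neg_mobius hd (neg_mem_curvSpace hz)
        rwa [neg_neg] at this
  have hinj : InjOn (mobius c z) (curvSpace c ∩ {u : ℂ | 1 - c * conj z * u ≠ 0}) := by
    intro u hu v hv huv
    rw [← mobius_neg_mobius hu.2 hz, ← mobius_neg_mobius hv.2 hz, huv]
  rw [lintegral_curvArea, lintegral_curvArea]
  conv_rhs => rw [hres (-z), ← himg]
  rw [lintegral_image_eq_lintegral_abs_det_fderiv_mul volume (good z)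
    (fun u hu => ((hasDerivAt_mobius hu.2).hasFDerivAt.restrictScalars ℝ).hasFDerivWithinAt) hinj,
    hres z]
  refine setLIntegral_congr_fun (good z) fun u hu => ?_
  rw [← mul_assoc]
  congr 1
  have hd := abs_det_toSpanSingleton
    (((1 + c * ‖z‖ ^ 2 : ℝ) : ℂ) / (1 - c * conj z * u) ^ 2)
  rw [← norm_deriv_mobius_mul hu.2 hz, mul_pow, ENNReal.ofReal_mul (sq_nonneg _)]
  congr 2
  exact hd.symm

/-! ### Averaging over random displacements. -/

/-- Averages over geodesic displacements of radial law. -/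
lemma lintegral_lintegral_mobius {c : ℝ} {G : ℂ → ℝ≥0∞} (hG : Measurable G) {w : ℝ → ℝ≥0∞}
    (hw : Measurable w) :
    ∫⁻ z, ∫⁻ u, G (mobius c z u) * w ‖u‖ ∂(curvArea c) ∂(curvArea c) =
      (∫⁻ z, G z ∂(curvArea c)) * ∫⁻ u, w ‖u‖ ∂(curvArea c) := by
  have hm : Measurable fun x : ℂ × ℂ => w ‖mobius c (-x.1) x.2‖ :=
    hw.comp ((measurable_mobius c).comp (measurable_fst.neg.prodMk measurable_snd)).norm
  have hm' : ∀ p : ℂ, Measurable fun z : ℂ => w ‖mobius c (-p) z‖ := fun p => by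
    have h := hm.comp (measurable_prodMk_left (x := p))
    simpa only [Function.comp_def] using h
  have hGm : Measurable fun x : ℂ × ℂ => G x.2 * w ‖mobius c (-x.1) x.2‖ :=
    (hG.comp measurable_snd).mul hm
  calc ∫⁻ z, ∫⁻ u, G (mobius c z u) * w ‖u‖ ∂(curvArea c) ∂(curvArea c)
      = ∫⁻ z, ∫⁻ p, G p * w ‖mobius c (-z) p‖ ∂(curvArea c) ∂(curvArea c) := by
        refine lintegral_congr_ae ?_
        filter_upwards [ae_mem_curvSpace c] with z hz
        rw [← lintegral_comp_mobius hz fun p => G p * w ‖mobius c (-z) p‖]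
        refine lintegral_congr_ae ?_
        filter_upwards [(curvArea_absolutelyContinuous c).ae_le (ae_mobius_den_ne_zero c z)]
          with u hu
        rw [mobius_neg_mobius hu hz]
    _ = ∫⁻ p, ∫⁻ z, G p * w ‖mobius c (-z) p‖ ∂(curvArea c) ∂(curvArea c) := by
        exact lintegral_lintegral_swap (f := fun z p => G p * w ‖mobius c (-z) p‖)
          hGm.aemeasurable
    -- By symmetry of the distance, the integral over starting points `z` is an integral over
    -- displacements from `p`, and by invariance it does not depend on `p`.
    _ = ∫⁻ p, G p * ∫⁻ u, w ‖u‖ ∂(curvArea c) ∂(curvArea c) := by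
        refine lintegral_congr_ae ?_
        filter_upwards [ae_mem_curvSpace c] with p hp
        rw [lintegral_const_mul]
        · rw [← lintegral_comp_mobius (neg_mem_curvSpace hp) fun u => w ‖u‖]
          simp_rw [norm_mobius_neg_comm c _ p]
        · simp_rw [norm_mobius_neg_comm c _ p]
          exact hm' p
    _ = _ := lintegral_mul_const _ hG

lemma lintegral_comp_real_smul {F : ℂ → ℝ≥0∞} (hF : Measurable F) {t : ℝ} (ht : 0 < t) :
    ∫⁻ u : ℂ, F (t * u) = ENNReal.ofReal ((t ^ 2)⁻¹) * ∫⁻ v : ℂ, F v := by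
  have h := Measure.map_addHaar_smul (volume : Measure ℂ) ht.ne'
  rw [Complex.finrank_real_complex, abs_of_nonneg (by positivity)] at h
  rw [← smul_eq_mul, ← lintegral_smul_measure, ← h,
    lintegral_map hF (measurable_const_smul t)]
  simp

/-- The radial density of the law of `t u` when `u` has radial density `w`. -/
def scaledDensity (c t : ℝ) (w : ℝ → ℝ≥0∞) (r : ℝ) : ℝ≥0∞ :=
  {s : ℝ | 0 < 1 + c * (s / t) ^ 2}.indicator (fun s => ENNReal.ofReal ((t ^ 2)⁻¹) *
    (ENNReal.ofReal ((1 / (1 + c * (s / t) ^ 2)) ^ 2 * (1 + c * s ^ 2) ^ 2) * w (s / t))) r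

lemma measurable_scaledDensity {c t : ℝ} {w : ℝ → ℝ≥0∞} (hw : Measurable w) :
    Measurable (scaledDensity c t w) := by
  refine Measurable.indicator ?_ (measurableSet_lt measurable_const (by fun_prop))
  have : Measurable fun s : ℝ => w (s / t) := hw.comp (by fun_prop)
  fun_prop

/-- A dilation does not preserve the area measure, but it carries radial densities to radial
densities, which is all that the averaging needs. The condition `t ≤ 1` keeps the dilated point in
the domain. -/
lemma lintegral_comp_smul_curvArea {c t : ℝ} (ht : 0 < t) (ht1 : t ≤ 1) {F : ℂ → ℝ≥0∞}
    (hF : Measurable F) {w : ℝ → ℝ≥0∞} (hw : Measurable w) :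
    ∫⁻ u, F (t * u) * w ‖u‖ ∂(curvArea c) =
      ∫⁻ v, F v * scaledDensity c t w ‖v‖ ∂(curvArea c) := by
  have hS := (isOpen_curvSpace c).measurableSet
  have hD : Measurable ((curvSpace c).indicator fun u : ℂ =>
      ENNReal.ofReal ((1 / (1 + c * ‖u‖ ^ 2)) ^ 2) * w ‖u‖) :=
    ((measurable_conformal c).mul (hw.comp measurable_norm)).indicator hS
  have htc : (t : ℂ) ≠ 0 := Complex.ofReal_ne_zero.2 ht.ne'
  have hsc : Measurable fun v : ℂ => ((t⁻¹ : ℝ) : ℂ) * v := by fun_prop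
  have hmeas : Measurable fun v : ℂ => F v * (curvSpace c).indicator (fun u : ℂ =>
      ENNReal.ofReal ((1 / (1 + c * ‖u‖ ^ 2)) ^ 2) * w ‖u‖) (((t⁻¹ : ℝ) : ℂ) * v) :=
    hF.mul (hD.comp hsc)
  have key := lintegral_comp_real_smul hmeas ht
  rw [← lintegral_const_mul _ hmeas] at key
  rw [lintegral_curvArea, lintegral_curvArea, ← lintegral_indicator hS, ← lintegral_indicator hS]
  calc _ = _ := lintegral_congr fun u => ?_
    _ = _ := key
    _ = _ := lintegral_congr fun v => ?_
  · have : ((t⁻¹ : ℝ) : ℂ) * (t * u) = u := by push_cast; field_simp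
    rw [this]
    by_cases hu : u ∈ curvSpace c
    · rw [indicator_of_mem hu, indicator_of_mem hu]; ring
    · rw [indicator_of_notMem hu, indicator_of_notMem hu, mul_zero]
  · have hn : ‖((t⁻¹ : ℝ) : ℂ) * v‖ = ‖v‖ / t := by
      rw [norm_mul, Complex.norm_real, Real.norm_of_nonneg (inv_nonneg.2 ht.le)]
      field_simp
    have hmem : ((t⁻¹ : ℝ) : ℂ) * v ∈ curvSpace c ↔ 0 < 1 + c * (‖v‖ / t) ^ 2 := by
      rw [← hn]; rfl
    by_cases hv : 0 < 1 + c * (‖v‖ / t) ^ 2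
    · have hv' : v ∈ curvSpace c := by
        rw [mem_curvSpace]
        have : ‖v‖ ^ 2 = t ^ 2 * (‖v‖ / t) ^ 2 := by field_simp
        rw [this]
        have ht2 : t ^ 2 ≤ 1 := pow_le_one₀ ht.le ht1
        nlinarith [sq_pos_of_pos ht]
      have h0 : (1 + c * ‖v‖ ^ 2) ≠ 0 := ne_of_gt hv'
      rw [indicator_of_mem (hmem.2 hv), indicator_of_mem hv', hn]
      unfold scaledDensity
      rw [indicator_of_mem (by exact hv)]
      have e : ENNReal.ofReal ((1 / (1 + c * (‖v‖ / t) ^ 2)) ^ 2) =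
          ENNReal.ofReal ((1 / (1 + c * ‖v‖ ^ 2)) ^ 2) *
          ENNReal.ofReal ((1 / (1 + c * (‖v‖ / t) ^ 2)) ^ 2 * (1 + c * ‖v‖ ^ 2) ^ 2) := by
        rw [← ENNReal.ofReal_mul (sq_nonneg _)]
        congr 1
        field_simp
      rw [e]; ring
    · rw [indicator_of_notMem (fun h => hv (hmem.1 h))]
      have h0 : scaledDensity c t w ‖v‖ = 0 := indicator_of_notMem (by exact hv) _
      rw [mul_zero, mul_zero]
      exact (indicator_apply_eq_zero.2 fun _ => by rw [h0, mul_zero, mul_zero]).symm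

/-- The point reached at time `t` is again a displacement of radial law, and the rescaled density
has the same total mass. Hence the value is the same for all times. -/
lemma lintegral_lintegral_mobius_smul {c t : ℝ} (ht : 0 < t) (ht1 : t ≤ 1) {G : ℂ → ℝ≥0∞}
    (hG : Measurable G) {w : ℝ → ℝ≥0∞} (hw : Measurable w) :
    ∫⁻ z, ∫⁻ u, G (mobius c z (t * u)) * w ‖u‖ ∂(curvArea c) ∂(curvArea c) =
      (∫⁻ z, G z ∂(curvArea c)) * ∫⁻ u, w ‖u‖ ∂(curvArea c) := by
  have h1 := lintegral_comp_smul_curvArea (c := c) ht ht1 (F := fun _ => 1) measurable_const hw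
  simp only [one_mul] at h1
  rw [h1, ← lintegral_lintegral_mobius hG (measurable_scaledDensity hw)]
  refine lintegral_congr fun z => ?_
  exact lintegral_comp_smul_curvArea ht ht1 (F := fun v => G (mobius c z v))
    (hG.comp ((measurable_mobius c).comp measurable_prodMk_left)) hw

/-! ### The energy of smooth functions, by integration along geodesics. -/

/-- The speed at time `t` of the path from `0` to a point at coordinate distance `r`. -/
def radialSpeed (c t r : ℝ) : ℝ≥0∞ := ENNReal.ofReal (r / (1 + c * (t * r) ^ 2))

/-- The length of the path from `0` to a point at coordinate distance `r`. -/
def radialLength (c r : ℝ) : ℝ≥0∞ := ∫⁻ t in Icc (0 : ℝ) 1, radialSpeed c t r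

lemma measurable_radialSpeed (c : ℝ) : Measurable fun x : ℝ × ℝ => radialSpeed c x.1 x.2 := by
  unfold radialSpeed; fun_prop

lemma measurable_radialLength (c : ℝ) : Measurable (radialLength c) :=
  Measurable.lintegral_prod_left' (f := fun x : ℝ × ℝ => radialSpeed c x.1 x.2)
    (measurable_radialSpeed c)

/-- A path through the pole forces `c z̄ u` to be real, which confines `u` to a line when `c z̄ ≠
0`; otherwise the denominator is `1`. -/
lemma ae_mobius_path_den_ne_zero (c : ℝ) (z : ℂ) :
    ∀ᵐ u : ℂ, ∀ t : ℝ, 1 - c * conj z * (t * u) ≠ 0 := by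
  set a : ℂ := c * conj z with ha
  by_cases h0 : a = 0
  · exact ae_of_all _ fun u t => by simp [h0]
  let φ : ℂ →ₗ[ℝ] ℝ := Complex.imLm ∘ₗ LinearMap.mulLeft ℝ a
  have hφ : (LinearMap.ker φ) ≠ ⊤ := fun h => by
    have : a⁻¹ * Complex.I ∈ LinearMap.ker φ := h ▸ Submodule.mem_top
    rw [LinearMap.mem_ker] at this
    simp [φ, mul_inv_cancel_left₀ h0] at this
  have hnull := Measure.addHaar_submodule (volume : Measure ℂ) _ hφ
  filter_upwards [measure_eq_zero_iff_ae_notMem.1 hnull] with u hu t h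
  refine hu ?_
  change (a * u).im = 0
  have h1 : (t : ℂ) * (a * u) = 1 := by linear_combination -h
  have h2 := congrArg Complex.im h1
  have h3 : t ≠ 0 := fun h3 => by simp [h3] at h1
  rw [Complex.im_ofReal_mul, Complex.one_im] at h2
  exact (mul_eq_zero.1 h2).resolve_left h3

/-- Cauchy–Schwarz against the constant `1` for the measure with density `q`. The weight is the
speed of a path in one application and a mollifier in another. -/
lemma sq_lintegral_mul_le {α : Type*} [MeasurableSpace α] (μ : Measure α) {G q : α → ℝ≥0∞}
    (hG : AEMeasurable G μ) (hq : Measurable q) :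
    (∫⁻ t, G t * q t ∂μ) ^ 2 ≤ (∫⁻ t, G t ^ 2 * q t ∂μ) * ∫⁻ t, q t ∂μ := by
  have h := ENNReal.lintegral_mul_le_Lp_mul_Lq (μ.withDensity q) Real.HolderConjugate.two_two
    (hG.mono_ac (withDensity_absolutelyContinuous _ _))
    (aemeasurable_const (b := (1 : ℝ≥0∞)))
  simp only [Pi.mul_apply, mul_one, ENNReal.one_rpow, lintegral_const, one_mul] at h
  have h2 : ∀ a : ℝ≥0∞, (a ^ (1 / (2 : ℝ))) ^ 2 = a := fun a => by
    rw [← ENNReal.rpow_natCast, ← ENNReal.rpow_mul]; norm_num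
  have h3 := pow_le_pow_left' h 2
  rw [mul_pow, h2, h2, withDensity_apply _ MeasurableSet.univ, Measure.restrict_univ,
    lintegral_withDensity_eq_lintegral_mul₀ hq.aemeasurable hG,
    lintegral_withDensity_eq_lintegral_mul₀ hq.aemeasurable (hG.pow_const _)] at h3
  simpa only [Pi.mul_apply, ENNReal.rpow_ofNat, mul_comm] using h3

lemma segment_mem_curvSpace {c t : ℝ} {u : ℂ} (hu : u ∈ curvSpace c) (ht : t ∈ Icc (0 : ℝ) 1) :
    (t * u : ℂ) ∈ curvSpace c := by
  have hu' : 0 < 1 + c * ‖u‖ ^ 2 := hu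
  rw [mem_curvSpace, norm_mul, Complex.norm_real, Real.norm_of_nonneg ht.1, mul_pow]
  have ht2 : t ^ 2 ≤ 1 := pow_le_one₀ ht.1 ht.2
  rcases (sq_nonneg t).eq_or_lt with h | h
  · rw [← h]; simp
  · nlinarith [mul_pos h hu']

/-- The intrinsic gradient length of `f`, cut off outside `D`. -/
def gradLength (c : ℝ) (D : Set ℂ) (f : ℂ → ℝ) : ℂ → ℝ≥0∞ :=
  D.indicator fun p => ‖fderiv ℝ f p‖ₑ * ENNReal.ofReal (1 + c * ‖p‖ ^ 2)

lemma measurable_gradLength {c : ℝ} {D : Set ℂ} (hD : MeasurableSet D) {f : ℂ → ℝ}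
    (hf : ContDiff ℝ 1 f) : Measurable (gradLength c D f) := by
  refine Measurable.indicator ?_ hD
  have := (hf.continuous_fderiv one_ne_zero).enorm.measurable
  fun_prop

/-- Conformal invariance of the Dirichlet integral in dimension two: the squared factor in the
gradient length cancels the area density. -/
lemma lintegral_gradLength_sq {c : ℝ} {D : Set ℂ} (hD : MeasurableSet D)
    (hDc : D ⊆ curvSpace c) (f : ℂ → ℝ) :
    ∫⁻ p, gradLength c D f p ^ 2 ∂(curvArea c) = ∫⁻ p in D, ‖fderiv ℝ f p‖ₑ ^ 2 := by
  rw [lintegral_curvArea, ← lintegral_indicator (isOpen_curvSpace c).measurableSet,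
    ← lintegral_indicator hD]
  refine lintegral_congr fun p => ?_
  by_cases hp : p ∈ D
  · have hpc := hDc hp
    have h0 : 0 < 1 + c * ‖p‖ ^ 2 := hpc
    rw [indicator_of_mem hp, indicator_of_mem hpc, gradLength, indicator_of_mem hp, mul_pow,
      mul_comm, mul_assoc, ← ENNReal.ofReal_pow h0.le, ← ENNReal.ofReal_mul (by positivity),
      ← mul_pow, mul_one_div_cancel h0.ne']
    simp
  · rw [indicator_of_notMem hp]
    refine indicator_apply_eq_zero.2 fun _ => ?_
    rw [gradLength, indicator_of_notMem hp]; simp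

/-- The fundamental theorem of calculus along the image of a radial segment. Since the translation
is an isometry, the intrinsic speed is that of the segment itself and does not involve `z`. -/
lemma enorm_sub_mobius_le {c : ℝ} {D : Set ℂ} {f : ℂ → ℝ} (hf : ContDiff ℝ 1 f) {z u : ℂ}
    (hz : z ∈ curvSpace c) (hu : u ∈ curvSpace c)
    (hden : ∀ t : ℝ, 1 - c * conj z * (t * u) ≠ 0)
    (hpath : ∀ t ∈ Icc (0 : ℝ) 1, mobius c z (t * u) ∈ D) :
    ‖f z - f (mobius c z u)‖ₑ ≤
      ∫⁻ t in Icc (0 : ℝ) 1, gradLength c D f (mobius c z (t * u)) * radialSpeed c t ‖u‖ := by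
  have hγd : ∀ t : ℝ, HasDerivAt (fun t : ℝ => mobius c z (t * u))
      (((1 + c * ‖z‖ ^ 2 : ℝ) : ℂ) / (1 - c * conj z * (t * u)) ^ 2 * u) t := fun t => by
    have h1 : HasDerivAt (fun s : ℂ => s * u) u (t : ℂ) := by
      simpa using (hasDerivAt_id (t : ℂ)).mul_const u
    exact ((hasDerivAt_mobius (hden t)).comp (t : ℂ) h1).comp_ofReal
  have hγ : ContDiff ℝ 1 fun t : ℝ => mobius c z (t * u) := by
    unfold mobius
    have h1 : ContDiff ℝ 1 fun t : ℝ => (z + t * u : ℂ) := by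
      have : ContDiff ℝ 1 fun t : ℝ => (t : ℂ) := Complex.ofRealCLM.contDiff
      fun_prop
    have h2 : ContDiff ℝ 1 fun t : ℝ => (1 - c * conj z * (t * u) : ℂ) := by
      have : ContDiff ℝ 1 fun t : ℝ => (t : ℂ) := Complex.ofRealCLM.contDiff
      fun_prop
    simp_rw [div_eq_mul_inv]
    exact h1.mul (h2.inv hden)
  have key := enorm_sub_le_lintegral_deriv_of_contDiffOn_Icc (hf.comp hγ).contDiffOn
    (zero_le_one (α := ℝ))
  have e1 : mobius c z ((1 : ℝ) * u) = mobius c z u := by simp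
  have e0 : mobius c z ((0 : ℝ) * u) = z := by simp [mobius]
  simp only [Function.comp_apply, e1, e0] at key
  rw [← enorm_neg, neg_sub]
  refine key.trans (setLIntegral_mono' measurableSet_Icc fun t ht => ?_)
  have hd := ((hf.differentiable one_ne_zero).differentiableAt.hasFDerivAt.comp_hasDerivAt t
    (hγd t)).deriv
  rw [show deriv (f ∘ fun t : ℝ => mobius c z (t * u)) t = _ from hd, gradLength,
    indicator_of_mem (hpath t ht), mul_assoc (‖_‖ₑ)]
  refine (ContinuousLinearMap.le_opENorm _ _).trans ?_
  gcongr
  have htu := segment_mem_curvSpace hu ht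
  have hp := mobius_mem_curvSpace (hden t) hz htu
  have hp' : 0 < 1 + c * ‖mobius c z (t * u)‖ ^ 2 := hp
  have hs := norm_deriv_mobius_mul (hden t) hz
  rw [mul_one_div, div_eq_iff hp'.ne'] at hs
  unfold radialSpeed
  rw [← ENNReal.ofReal_mul hp'.le, ← ofReal_norm, norm_mul, hs, norm_mul,
    Complex.norm_real, Real.norm_of_nonneg ht.1]
  refine ENNReal.ofReal_le_ofReal (le_of_eq ?_)
  ring

/-- Cauchy–Schwarz with the speed as weight produces one factor of the length. With time as the
outermost variable, the average over `z` and `u` factorises, and integrating the speed over time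
produces the second factor. As `D` contains the paths between its points, only the gradient on `D`
enters. -/
lemma lintegral_sub_sq_mobius_le {c : ℝ} {D : Set ℂ} (hDm : MeasurableSet D)
    (hDc : D ⊆ curvSpace c)
    (hpath : ∀ z ∈ D, ∀ u ∈ curvSpace c, mobius c z u ∈ D →
      (∀ t : ℝ, 1 - c * conj z * (t * u) ≠ 0) →
      ∀ t ∈ Icc (0 : ℝ) 1, mobius c z (t * u) ∈ D)
    {f : ℂ → ℝ} (hf : ContDiff ℝ 1 f) {H : ℝ → ℝ≥0∞} (hH : Measurable H) :
    ∫⁻ x in D ×ˢ D, ‖f x.1 - f x.2‖ₑ ^ 2 * H ‖mobius c (-x.1) x.2‖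
        ∂((curvArea c).prod (curvArea c)) ≤
      (∫⁻ p in D, ‖fderiv ℝ f p‖ₑ ^ 2) *
        ∫⁻ u, radialLength c ‖u‖ ^ 2 * H ‖u‖ ∂(curvArea c) := by
  set ν := curvArea c
  have hGm := measurable_gradLength (c := c) hDm hf
  set G := gradLength c D f
  have hfm := hf.continuous.measurable
  have hHm : Measurable fun x : ℂ × ℂ => H ‖mobius c (-x.1) x.2‖ :=
    hH.comp ((measurable_mobius c).comp (measurable_fst.neg.prodMk measurable_snd)).norm
  have hFm : Measurable ((D ×ˢ D).indicator fun x : ℂ × ℂ =>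
      ‖f x.1 - f x.2‖ₑ ^ 2 * H ‖mobius c (-x.1) x.2‖) := by
    refine Measurable.indicator ?_ (hDm.prod hDm)
    have : Measurable fun x : ℂ × ℂ => f x.1 - f x.2 :=
      (hfm.comp measurable_fst).sub (hfm.comp measurable_snd)
    exact (this.enorm.pow_const 2).mul hHm
  have hGmob : Measurable fun y : (ℂ × ℂ) × ℝ => G (mobius c y.1.1 (y.2 * y.1.2)) := by
    have h1 : Measurable fun y : (ℂ × ℂ) × ℝ => (y.2 * y.1.2 : ℂ) :=
      (Complex.measurable_ofReal.comp measurable_snd).mul measurable_fst.snd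
    exact hGm.comp ((measurable_mobius c).comp (measurable_fst.fst.prodMk h1))
  have hqm : Measurable fun y : (ℂ × ℂ) × ℝ => radialSpeed c y.2 ‖y.1.2‖ :=
    (measurable_radialSpeed c).comp (measurable_snd.prodMk measurable_fst.snd.norm)
  have hLH : Measurable fun r : ℝ => radialLength c r * H r := (measurable_radialLength c).mul hH
  have hint : Measurable fun y : (ℂ × ℂ) × ℝ => G (mobius c y.1.1 (y.2 * y.1.2)) ^ 2 *
      (radialSpeed c y.2 ‖y.1.2‖ * (radialLength c ‖y.1.2‖ * H ‖y.1.2‖)) :=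
    (hGmob.pow_const 2).mul (hqm.mul (hLH.comp measurable_fst.snd.norm))
  calc ∫⁻ x in D ×ˢ D, ‖f x.1 - f x.2‖ₑ ^ 2 * H ‖mobius c (-x.1) x.2‖ ∂(ν.prod ν)
      = ∫⁻ z, ∫⁻ w, (D ×ˢ D).indicator (fun x : ℂ × ℂ =>
          ‖f x.1 - f x.2‖ₑ ^ 2 * H ‖mobius c (-x.1) x.2‖) (z, w) ∂ν ∂ν := by
        rw [← lintegral_indicator (hDm.prod hDm), lintegral_prod _ hFm.aemeasurable]
    _ ≤ ∫⁻ z, ∫⁻ u, ∫⁻ t in Icc (0 : ℝ) 1, G (mobius c z (t * u)) ^ 2 *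
          (radialSpeed c t ‖u‖ * (radialLength c ‖u‖ * H ‖u‖)) ∂volume ∂ν ∂ν := by
        refine lintegral_mono_ae ?_
        filter_upwards [ae_mem_curvSpace c] with z hz
        rw [← lintegral_comp_mobius hz]
        refine lintegral_mono_ae ?_
        filter_upwards [ae_mem_curvSpace c, (curvArea_absolutelyContinuous c).ae_le
          (ae_mobius_path_den_ne_zero c z)] with u hu hden
        by_cases hx : (z, mobius c z u) ∈ D ×ˢ D
        · have hd1 := hden 1
          rw [Complex.ofReal_one, one_mul] at hd1
          rw [indicator_of_mem hx, mobius_neg_mobius hd1 hz]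
          have h1 := enorm_sub_mobius_le (D := D) hf hz hu hden
            (hpath z hx.1 u hu hx.2 hden)
          have hg : Measurable fun t : ℝ => G (mobius c z (t * u)) := by
            have := hGmob.comp (measurable_prodMk_left (x := (z, u)))
            simpa only [Function.comp_def] using this
          have hq : Measurable fun t : ℝ => radialSpeed c t ‖u‖ := by
            have := hqm.comp (measurable_prodMk_left (x := (z, u)))
            simpa only [Function.comp_def] using this
          have h2 := sq_lintegral_mul_le (volume.restrict (Icc (0 : ℝ) 1)) hg.aemeasurable hq
          calc _ ≤ ((∫⁻ t in Icc (0 : ℝ) 1, G (mobius c z (t * u)) ^ 2 * radialSpeed c t ‖u‖) *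
                radialLength c ‖u‖) * H ‖u‖ := by
                gcongr
                exact (pow_le_pow_left' h1 2).trans h2
            _ = _ := by
                rw [mul_assoc, ← lintegral_mul_const (f := fun t : ℝ =>
                  G (mobius c z (t * u)) ^ 2 * radialSpeed c t ‖u‖) _ ((hg.pow_const 2).mul hq)]
                simp_rw [mul_assoc]
        · rw [indicator_of_notMem hx]; exact zero_le
    _ = ∫⁻ t in Icc (0 : ℝ) 1, ∫⁻ z, ∫⁻ u, G (mobius c z (t * u)) ^ 2 *
          (radialSpeed c t ‖u‖ * (radialLength c ‖u‖ * H ‖u‖)) ∂ν ∂ν := by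
        have e1 : ∀ z, ∫⁻ u, ∫⁻ t in Icc (0 : ℝ) 1, G (mobius c z (t * u)) ^ 2 *
            (radialSpeed c t ‖u‖ * (radialLength c ‖u‖ * H ‖u‖)) ∂volume ∂ν =
            ∫⁻ t in Icc (0 : ℝ) 1, ∫⁻ u, G (mobius c z (t * u)) ^ 2 *
            (radialSpeed c t ‖u‖ * (radialLength c ‖u‖ * H ‖u‖)) ∂ν := fun z => by
          refine lintegral_lintegral_swap (f := fun (u : ℂ) (t : ℝ) => G (mobius c z (t * u)) ^ 2 *
            (radialSpeed c t ‖u‖ * (radialLength c ‖u‖ * H ‖u‖))) (Measurable.aemeasurable ?_)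
          have := hint.comp (f := fun x : ℂ × ℝ => ((z, x.1), x.2)) (by fun_prop)
          simpa only [Function.comp_def, Function.uncurry_def] using this
        simp_rw [e1]
        refine lintegral_lintegral_swap
          (f := fun (z : ℂ) (t : ℝ) => ∫⁻ u, G (mobius c z (t * u)) ^ 2 *
          (radialSpeed c t ‖u‖ * (radialLength c ‖u‖ * H ‖u‖)) ∂ν) (Measurable.aemeasurable ?_)
        have := hint.comp (f := fun x : (ℂ × ℝ) × ℂ => ((x.1.1, x.2), x.1.2)) (by fun_prop)
        exact Measurable.lintegral_prod_right' (ν := ν) this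
    _ = ∫⁻ t in Icc (0 : ℝ) 1, (∫⁻ p, G p ^ 2 ∂ν) *
          ∫⁻ u, radialSpeed c t ‖u‖ * (radialLength c ‖u‖ * H ‖u‖) ∂ν := by
        -- Time `0` is discarded, because the dilation by `0` has no density.
        rw [setLIntegral_congr Ioc_ae_eq_Icc.symm, setLIntegral_congr Ioc_ae_eq_Icc.symm]
        refine setLIntegral_congr_fun measurableSet_Ioc fun t ht => ?_
        refine lintegral_lintegral_mobius_smul ht.1 ht.2 (hGm.pow_const 2)
          (w := fun r => radialSpeed c t r * (radialLength c r * H r)) ?_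
        have := (measurable_radialSpeed c).comp (measurable_prodMk_left (x := t))
        exact Measurable.mul this hLH
    _ = (∫⁻ p, G p ^ 2 ∂ν) * ∫⁻ t in Icc (0 : ℝ) 1,
          ∫⁻ u, radialSpeed c t ‖u‖ * (radialLength c ‖u‖ * H ‖u‖) ∂ν := by
        refine lintegral_const_mul _ ?_
        refine Measurable.lintegral_prod_right' (ν := ν) (f := fun x : ℝ × ℂ =>
          radialSpeed c x.1 ‖x.2‖ * (radialLength c ‖x.2‖ * H ‖x.2‖)) ?_
        exact ((measurable_radialSpeed c).comp (measurable_fst.prodMk measurable_snd.norm)).mul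
          (hLH.comp measurable_snd.norm)
    _ = (∫⁻ p, G p ^ 2 ∂ν) * ∫⁻ u, radialLength c ‖u‖ ^ 2 * H ‖u‖ ∂ν := by
        congr 1
        rw [lintegral_lintegral_swap (f := fun t u => radialSpeed c t ‖u‖ *
          (radialLength c ‖u‖ * H ‖u‖)) (Measurable.aemeasurable
          (((measurable_radialSpeed c).comp (measurable_fst.prodMk measurable_snd.norm)).mul
          (hLH.comp measurable_snd.norm)))]
        refine lintegral_congr fun u => ?_
        have : Measurable fun t : ℝ => radialSpeed c t ‖u‖ := by
          have := (measurable_radialSpeed c).comp (measurable_prodMk_right (y := ‖u‖))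
          simpa only [Function.comp_def] using this
        rw [lintegral_mul_const _ this, sq, mul_assoc]
        rfl
    _ = _ := by rw [lintegral_gradLength_sq hDm hDc]

/-- Geodesic convexity of concentric discs in the hyperbolic plane. After clearing denominators,
membership at time `s` says that a quadratic in `s` is negative; its leading coefficient is
non-negative and it is negative at both ends. -/
lemma mobius_path_mem_ball {R : ℝ} (hR : R < 1) {z u : ℂ} (hz : z ∈ Metric.ball (0 : ℂ) R)
    (hzu : mobius (-1) z u ∈ Metric.ball (0 : ℂ) R)
    (hden : ∀ t : ℝ, 1 - ((-1 : ℝ) : ℂ) * conj z * (t * u) ≠ 0) {t : ℝ} (ht : t ∈ Icc (0 : ℝ) 1) :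
    mobius (-1) z (t * u) ∈ Metric.ball (0 : ℂ) R := by
  rw [mem_ball_zero_iff] at *
  have hR0 : 0 < R := (norm_nonneg z).trans_lt hz
  have hiff : ∀ s : ℝ, ‖mobius (-1) z (s * u)‖ < R ↔
      ‖z‖ ^ 2 - R ^ 2 + 2 * s * ((1 - R ^ 2) * (conj z * u).re) +
        s ^ 2 * (‖u‖ ^ 2 * (1 - R ^ 2 * ‖z‖ ^ 2)) < 0 := fun s => by
    have hpos : 0 < ‖1 - ((-1 : ℝ) : ℂ) * conj z * (s * u)‖ := norm_pos_iff.2 (hden s)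
    rw [mobius, norm_div, div_lt_iff₀ hpos, ← sq_lt_sq₀ (norm_nonneg _) (by positivity),
      mul_pow, ← sub_neg]
    refine iff_of_eq (congrArg (· < 0) ?_)
    simp only [Complex.sq_norm, Complex.normSq_apply, Complex.sub_re, Complex.sub_im,
      Complex.mul_re, Complex.mul_im, Complex.conj_re, Complex.conj_im, Complex.ofReal_re,
      Complex.ofReal_im, Complex.one_re, Complex.one_im, Complex.add_re, Complex.add_im]
    ring
  rw [hiff]
  have h1 := (hiff 1).1 (by simpa using hzu)
  have h0 : ‖z‖ ^ 2 - R ^ 2 < 0 := by nlinarith [norm_nonneg z]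
  have hz1 : 0 ≤ 1 - R ^ 2 * ‖z‖ ^ 2 := by
    have : R * ‖z‖ ≤ 1 := by nlinarith [norm_nonneg z]
    nlinarith [mul_nonneg hR0.le (norm_nonneg z)]
  have hA : 0 ≤ ‖u‖ ^ 2 * (1 - R ^ 2 * ‖z‖ ^ 2) := by positivity
  set A := ‖u‖ ^ 2 * (1 - R ^ 2 * ‖z‖ ^ 2)
  set B := (1 - R ^ 2) * (conj z * u).re
  set C := ‖z‖ ^ 2 - R ^ 2
  obtain ⟨ht0, ht1⟩ := ht
  rcases eq_or_lt_of_le ht0 with h | h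
  · rw [← h]; simpa using h0
  · nlinarith [mul_nonneg hA (mul_nonneg ht0 (sub_nonneg.2 ht1)),
      mul_pos h (neg_pos.2 h1), mul_nonneg (sub_nonneg.2 ht1) (neg_pos.2 h0).le]

/-! ### Mollification, and the energy bound for weak gradients. -/

lemma hasFDerivAt_mollify {F : ℂ → ℝ} (hF : LocallyIntegrable F volume)
    (φ : ContDiffBump (0 : ℂ)) (z v : ℂ) :
    fderiv ℝ (φ.normed volume ⋆[ContinuousLinearMap.lsmul ℝ ℝ, volume] F) z v =
      ∫ t, fderiv ℝ (φ.normed volume) (z - t) v * F t := by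
  have hc : HasCompactSupport (φ.normed (volume : Measure ℂ)) := φ.hasCompactSupport_normed
  have hd : ContDiff ℝ 1 (φ.normed (volume : Measure ℂ)) := φ.contDiff_normed
  rw [(hc.hasFDerivAt_convolution_left (ContinuousLinearMap.lsmul ℝ ℝ) hd hF z).fderiv,
    convolution_eq_swap, ContinuousLinearMap.integral_apply]
  · simp [ContinuousLinearMap.precompL_apply]
  · have := ((hc.fderiv (𝕜 := ℝ)).convolutionExists_left
      (L := (ContinuousLinearMap.lsmul ℝ ℝ : ℝ →L[ℝ] ℝ →L[ℝ] ℝ).precompL ℂ)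
      (hd.continuous_fderiv one_ne_zero) hF z).integrable_swap
    exact this

/-- The gradient of a mollified function is the mollified weak gradient. -/
lemma enorm_fderiv_mollify_le {U V : Set ℂ} {f : ℂ → ℝ} {g : ℂ → ℂ}
    (hfg : HasWeakGradientOn U f g) (hU : MeasurableSet U) (hVU : V ⊆ U)
    (hfV : LocallyIntegrable (V.indicator f) volume) (φ : ContDiffBump (0 : ℂ)) {z : ℂ}
    (hz : Metric.closedBall z φ.rOut ⊆ V) :
    ‖fderiv ℝ (φ.normed volume ⋆[ContinuousLinearMap.lsmul ℝ ℝ, volume] V.indicator f) z‖ₑ ≤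
      ∫⁻ t, ‖V.indicator g t‖ₑ * ENNReal.ofReal (φ.normed volume (z - t)) := by
  have hd : ContDiff ℝ (⊤ : ℕ∞) (φ.normed (volume : Measure ℂ)) := φ.contDiff_normed
  set ψ : ℂ → ℝ := fun t => φ.normed volume (z - t) with hψ
  have hψd : ContDiff ℝ (⊤ : ℕ∞) ψ := hd.comp (contDiff_const.sub contDiff_id)
  have hψs : tsupport ψ ⊆ Metric.closedBall z φ.rOut := by
    refine closure_minimal (fun t ht => ?_) Metric.isClosed_closedBall
    have h1 : z - t ∈ Function.support (φ.normed (volume : Measure ℂ)) := ht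
    rw [φ.support_normed_eq, mem_ball_zero_iff] at h1
    rw [Metric.mem_closedBall, dist_comm, dist_eq_norm]
    exact h1.le
  have hψc : HasCompactSupport ψ := (isCompact_closedBall z φ.rOut).of_isClosed_subset
    (isClosed_tsupport _) hψs
  -- The support of the test function `ψ` lies in `V`, so `ψ` and its derivative do not feel that
  -- `f` and `g` are cut off outside `V`.
  have hψ0 : ∀ t ∉ V, ψ t = 0 := fun t ht => image_eq_zero_of_notMem_tsupport fun h =>
    ht (hz (hψs h))
  have hψ0' : ∀ t ∉ V, fderiv ℝ ψ t = 0 := fun t ht =>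
    image_eq_zero_of_notMem_tsupport (f := fderiv ℝ ψ) fun h =>
      ht (hz (hψs (tsupport_fderiv_subset ℝ h)))
  have hψf : ∀ t v, fderiv ℝ ψ t v = -fderiv ℝ (φ.normed volume) (z - t) v := fun t v => by
    have h1 := (hd.differentiable (by simp)).differentiableAt.hasFDerivAt.comp t
      ((hasFDerivAt_id (𝕜 := ℝ) t).const_sub z)
    have h2 : fderiv ℝ ψ t = _ := h1.fderiv
    rw [h2]; simp
  have hval : ∀ v : ℂ, fderiv ℝ
      (φ.normed volume ⋆[ContinuousLinearMap.lsmul ℝ ℝ, volume] V.indicator f) z v =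
      ∫ t, inner ℝ (V.indicator g t) v * ψ t := fun v => by
    have h1 := hfg.integral_eq ψ hψd hψc ((hψs.trans hz).trans hVU) v
    rw [hasFDerivAt_mollify hfV, ← neg_inj, ← integral_neg]
    calc ∫ t, -(fderiv ℝ (φ.normed volume) (z - t) v * V.indicator f t)
        = ∫ t, U.indicator (fun t => f t * fderiv ℝ ψ t v) t := by
          refine integral_congr_ae (ae_of_all _ fun t => ?_)
          by_cases ht : t ∈ V
          · simp only [indicator_of_mem ht, indicator_of_mem (hVU ht), hψf]; ring
          · simp only [indicator_of_notMem ht]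
            rw [mul_zero, neg_zero]
            exact (indicator_apply_eq_zero.2 fun _ => by rw [hψ0' t ht]; simp).symm
      _ = -∫ t, U.indicator (fun t => inner ℝ (g t) v * ψ t) t := by
          rw [integral_indicator hU, integral_indicator hU]; exact h1
      _ = _ := by
          congr 1
          refine integral_congr_ae (ae_of_all _ fun t => ?_)
          by_cases ht : t ∈ V
          · simp only [indicator_of_mem ht, indicator_of_mem (hVU ht)]
          · simp only [indicator_of_notMem ht, inner_zero_left, zero_mul]
            exact indicator_apply_eq_zero.2 fun _ => by rw [hψ0 t ht, mul_zero]
  refine ContinuousLinearMap.opENorm_le_bound _ fun v => ?_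
  rw [hval]
  refine (enorm_integral_le_lintegral_enorm _).trans ?_
  rw [mul_comm, ← lintegral_const_mul' _ _ enorm_ne_top]
  refine lintegral_mono fun t => ?_
  simp only
  rw [enorm_mul, ← mul_assoc, mul_comm ‖v‖ₑ,
    Real.enorm_of_nonneg (φ.nonneg_normed (μ := volume) (z - t))]
  gcongr
  rw [← ofReal_norm, ← ofReal_norm, ← ofReal_norm, ← ENNReal.ofReal_mul (norm_nonneg _)]
  exact ENNReal.ofReal_le_ofReal (norm_inner_le_norm _ _)

/-- Averaging against a bump of mass one does not increase the `L²` norm, by Cauchy–Schwarz and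
Tonelli. -/
lemma lintegral_enorm_fderiv_mollify_sq_le {U V D : Set ℂ} {f : ℂ → ℝ} {g : ℂ → ℂ}
    (hfg : HasWeakGradientOn U f g) (hU : MeasurableSet U) (hVU : V ⊆ U)
    (hV : MeasurableSet V) (hD : MeasurableSet D)
    (hfV : LocallyIntegrable (V.indicator f) volume)
    (hgV : LocallyIntegrable (V.indicator g) volume) (φ : ContDiffBump (0 : ℂ))
    (hDV : ∀ z ∈ D, Metric.closedBall z φ.rOut ⊆ V) :
    ∫⁻ z in D, ‖fderiv ℝ (φ.normed volume ⋆[ContinuousLinearMap.lsmul ℝ ℝ, volume]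
      V.indicator f) z‖ₑ ^ 2 ≤ ∫⁻ z in V, ‖g z‖ₑ ^ 2 := by
  have hφm : Measurable (φ.normed (volume : Measure ℂ)) := φ.continuous_normed.measurable
  have hone : ∫⁻ t : ℂ, ENNReal.ofReal (φ.normed volume t) = 1 := by
    rw [← ofReal_integral_eq_lintegral_ofReal φ.integrable_normed
      (ae_of_all _ fun t => φ.nonneg_normed t), φ.integral_normed, ENNReal.ofReal_one]
  have hg := hgV.aestronglyMeasurable.enorm
  calc _ ≤ ∫⁻ z in D, ∫⁻ t, ‖V.indicator g t‖ₑ ^ 2 *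
        ENNReal.ofReal (φ.normed volume (z - t)) := by
        refine setLIntegral_mono' hD fun z hz => ?_
        refine (pow_le_pow_left' (enorm_fderiv_mollify_le hfg hU hVU hfV φ (hDV z hz)) 2).trans ?_
        refine (sq_lintegral_mul_le volume hg (by fun_prop)).trans_eq ?_
        rw [lintegral_sub_left_eq_self (fun t : ℂ => ENNReal.ofReal (φ.normed volume t)), hone,
          mul_one]
    _ ≤ ∫⁻ z, ∫⁻ t, ‖V.indicator g t‖ₑ ^ 2 * ENNReal.ofReal (φ.normed volume (z - t)) :=
        setLIntegral_le_lintegral _ _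
    _ = ∫⁻ t, ∫⁻ z, ‖V.indicator g t‖ₑ ^ 2 * ENNReal.ofReal (φ.normed volume (z - t)) := by
        have h1 : AEMeasurable (fun x : ℂ × ℂ => ‖V.indicator g x.2‖ₑ ^ 2 *
            ENNReal.ofReal (φ.normed volume (x.1 - x.2))) (volume.prod volume) :=
          (hg.pow_const 2).comp_snd.mul (Measurable.ennreal_ofReal (hφm.comp
            (measurable_fst.sub measurable_snd))).aemeasurable
        exact lintegral_lintegral_swap (f := fun z t : ℂ => ‖V.indicator g t‖ₑ ^ 2 *
          ENNReal.ofReal (φ.normed volume (z - t))) h1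
    _ = ∫⁻ t, V.indicator (fun t => ‖g t‖ₑ ^ 2) t := by
        refine lintegral_congr fun t => ?_
        rw [lintegral_const_mul _ (by fun_prop),
          lintegral_sub_right_eq_self (fun t : ℂ => ENNReal.ofReal (φ.normed volume t)), hone,
          mul_one]
        by_cases ht : t ∈ V
        · simp only [indicator_of_mem ht]
        · simp [indicator_of_notMem ht]
    _ = _ := lintegral_indicator hV _

/-- The smooth bound holds for the mollifications with a right side that does not depend on the
scale. They converge almost everywhere, so Fatou gives the bound for `f`. The margin `δ` leaves room
to mollify at points of `D` inside `V`. -/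
lemma lintegral_sub_sq_le_of_subset {c δ : ℝ} (hδ : 0 < δ) {V D : Set ℂ} {f : ℂ → ℝ} {g : ℂ → ℂ}
    (hfg : HasWeakGradientOn (curvSpace c) f g) (hVU : V ⊆ curvSpace c)
    (hV : MeasurableSet V) (hD : MeasurableSet D)
    (hfV : LocallyIntegrable (V.indicator f) volume)
    (hgV : LocallyIntegrable (V.indicator g) volume)
    (hDV : ∀ z ∈ D, Metric.closedBall z δ ⊆ V)
    (hpath : ∀ z ∈ D, ∀ u ∈ curvSpace c, mobius c z u ∈ D →
      (∀ t : ℝ, 1 - c * conj z * (t * u) ≠ 0) →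
      ∀ t ∈ Icc (0 : ℝ) 1, mobius c z (t * u) ∈ D)
    {H : ℝ → ℝ≥0∞} (hH : Measurable H) (hHt : ∀ r, H r ≠ ∞) :
    ∫⁻ x in D ×ˢ D, ‖f x.1 - f x.2‖ₑ ^ 2 * H ‖mobius c (-x.1) x.2‖
        ∂((curvArea c).prod (curvArea c)) ≤
      (∫⁻ p in curvSpace c, ‖g p‖ₑ ^ 2) *
        ∫⁻ u, radialLength c ‖u‖ ^ 2 * H ‖u‖ ∂(curvArea c) := by
  -- Inner and outer radii stay in the ratio `1 : 2`, because almost everywhere convergence of the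
  -- mollifications needs a bounded ratio; this is `K = 2` below.
  let φ : ℕ → ContDiffBump (0 : ℂ) := fun n =>
    ⟨δ / (n + 1) / 2, δ / (n + 1), by positivity, half_lt_self (by positivity)⟩
  have hrle : ∀ n, (φ n).rOut ≤ δ := fun n => by
    have : (0 : ℝ) ≤ n := n.cast_nonneg
    exact div_le_self hδ.le (by linarith)
  have hr0 : Tendsto (fun n => (φ n).rOut) atTop (𝓝 0) := by
    have := (tendsto_one_div_add_atTop_nhds_zero_nat (𝕜 := ℝ)).const_mul δ
    simpa [φ, div_eq_mul_inv] using this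
  let F : ℕ → ℂ → ℝ := fun n =>
    (φ n).normed volume ⋆[ContinuousLinearMap.lsmul ℝ ℝ, volume] V.indicator f
  have hFs : ∀ n, ContDiff ℝ 1 (F n) := fun n =>
    (φ n).hasCompactSupport_normed.contDiff_convolution_left _ (n := 1)
      (φ n).contDiff_normed hfV
  have hlim : ∀ᵐ z : ℂ, Tendsto (fun n => F n z) atTop (𝓝 (V.indicator f z)) :=
    ContDiffBump.ae_convolution_tendsto_right_of_locallyIntegrable (K := 2) hr0
      (Eventually.of_forall fun n => by simp only [φ]; linarith) hfV
  have hlim' : ∀ᵐ z ∂(curvArea c), Tendsto (fun n => F n z) atTop (𝓝 (V.indicator f z)) :=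
    (curvArea_absolutelyContinuous c).ae_le hlim
  have hHm : Measurable fun x : ℂ × ℂ => H ‖mobius c (-x.1) x.2‖ :=
    hH.comp ((measurable_mobius c).comp (measurable_fst.neg.prodMk measurable_snd)).norm
  have hDV' : D ⊆ V := fun z hz => hDV z hz (Metric.mem_closedBall_self hδ.le)
  calc _ ≤ ∫⁻ x in D ×ˢ D, liminf (fun n => ‖F n x.1 - F n x.2‖ₑ ^ 2 *
        H ‖mobius c (-x.1) x.2‖) atTop ∂((curvArea c).prod (curvArea c)) := by
        refine lintegral_mono_ae ?_
        filter_upwards [ae_restrict_mem (hD.prod hD),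
          ae_restrict_of_ae (Measure.quasiMeasurePreserving_fst.ae hlim'),
          ae_restrict_of_ae (Measure.quasiMeasurePreserving_snd.ae hlim')] with x hx h1 h2
        rw [indicator_of_mem (hDV' hx.1)] at h1
        rw [indicator_of_mem (hDV' hx.2)] at h2
        refine le_of_eq (Tendsto.liminf_eq ?_).symm
        refine ENNReal.Tendsto.mul_const ?_ (Or.inr (hHt _))
        exact ((ENNReal.continuous_pow 2).tendsto _).comp (h1.sub h2).enorm
    _ ≤ liminf (fun n => ∫⁻ x in D ×ˢ D, ‖F n x.1 - F n x.2‖ₑ ^ 2 *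
        H ‖mobius c (-x.1) x.2‖ ∂((curvArea c).prod (curvArea c))) atTop := by
        refine lintegral_liminf_le fun n => ?_
        have : Measurable fun x : ℂ × ℂ => F n x.1 - F n x.2 :=
          ((hFs n).continuous.measurable.comp measurable_fst).sub
            ((hFs n).continuous.measurable.comp measurable_snd)
        exact (this.enorm.pow_const 2).mul hHm
    _ ≤ _ := by
        refine liminf_le_of_le (by isBoundedDefault) fun b hb => ?_
        obtain ⟨n, hn⟩ := hb.exists
        refine hn.trans ((lintegral_sub_sq_mobius_le hD (hDV'.trans hVU) hpath (hFs n) hH).trans ?_)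
        gcongr ?_ * _
        refine (lintegral_enorm_fderiv_mollify_sq_le hfg (isOpen_curvSpace c).measurableSet hVU hV
          hD hfV hgV (φ n) fun z hz => ?_).trans (lintegral_mono_set hVU)
        exact (Metric.closedBall_subset_closedBall (hrle n)).trans (hDV z hz)

lemma curvSpace_eq_univ {c : ℝ} (hc : 0 ≤ c) : curvSpace c = univ :=
  eq_univ_of_forall fun z => by rw [mem_curvSpace]; positivity

lemma curvSpace_neg_one : curvSpace (-1) = Metric.ball 0 1 := by
  ext z
  rw [mem_curvSpace, mem_ball_zero_iff, ← sq_lt_one_iff₀ (norm_nonneg z)]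
  constructor <;> intro h <;> linarith

/-- The energy of a function against an isometry invariant radial kernel is bounded by its
Dirichlet energy. -/
theorem lintegral_sub_sq_le {c : ℝ} (hc : 0 ≤ c ∨ c = -1) {f : ℂ → ℝ} {g : ℂ → ℂ}
    (hfg : HasWeakGradientOn (curvSpace c) f g)
    {H : ℝ → ℝ≥0∞} (hH : Measurable H) (hHt : ∀ r, H r ≠ ∞) :
    ∫⁻ x, ‖f x.1 - f x.2‖ₑ ^ 2 * H ‖mobius c (-x.1) x.2‖
        ∂((curvArea c).prod (curvArea c)) ≤
      (∫⁻ p in curvSpace c, ‖g p‖ₑ ^ 2) *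
        ∫⁻ u, radialLength c ‖u‖ ^ 2 * H ‖u‖ ∂(curvArea c) := by
  have hf := hfg.locallyIntegrable
  have hg := hfg.locallyIntegrable_grad
  rcases hc with hc | rfl
  · have hu := curvSpace_eq_univ hc
    rw [hu, locallyIntegrableOn_univ] at hf hg
    have := lintegral_sub_sq_le_of_subset (V := univ) (D := univ) one_pos hfg hu.ge
      MeasurableSet.univ MeasurableSet.univ (by rwa [indicator_univ]) (by rwa [indicator_univ])
      (fun _ _ => subset_univ _) (fun _ _ _ _ _ _ _ _ => mem_univ _) hH hHt
    rwa [univ_prod_univ, Measure.restrict_univ] at this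
  -- In the disk `f` and `g` need not be integrable up to the boundary. The bound is proved on the
  -- ball of radius `R n`, mollifying within the closed ball that reaches halfway to the unit
  -- circle, and the balls exhaust the disk.
  · let R : ℕ → ℝ := fun n => 1 - 1 / ((n : ℝ) + 1)
    have hR1 : ∀ n : ℕ, 0 < 1 / ((n : ℝ) + 1) := fun n => by positivity
    have hRm : Monotone R := fun n k hnk => by
      have : (n : ℝ) ≤ k := by exact_mod_cast hnk
      exact sub_le_sub_left (one_div_le_one_div_of_le (Nat.cast_add_one_pos n)
        (by linarith)) _
    have hbound : ∀ n, ∫⁻ x in Metric.ball 0 (R n) ×ˢ Metric.ball 0 (R n),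
        ‖f x.1 - f x.2‖ₑ ^ 2 * H ‖mobius (-1) (-x.1) x.2‖
        ∂((curvArea (-1)).prod (curvArea (-1))) ≤ (∫⁻ p in curvSpace (-1), ‖g p‖ₑ ^ 2) *
        ∫⁻ u, radialLength (-1) ‖u‖ ^ 2 * H ‖u‖ ∂(curvArea (-1)) := fun n => by
      have hsub : Metric.closedBall (0 : ℂ) (R n + 1 / ((n : ℝ) + 1) / 2) ⊆ curvSpace (-1) := by
        rw [curvSpace_neg_one]
        exact Metric.closedBall_subset_ball (by have := hR1 n; simp only [R]; linarith)
      have hK := isCompact_closedBall (0 : ℂ) (R n + 1 / ((n : ℝ) + 1) / 2)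
      refine lintegral_sub_sq_le_of_subset (half_pos (hR1 n)) hfg hsub hK.measurableSet
        measurableSet_ball
        ((hf.integrableOn_compact_subset hsub hK).integrable_indicator
          hK.measurableSet).locallyIntegrable
        ((hg.integrableOn_compact_subset hsub hK).integrable_indicator
          hK.measurableSet).locallyIntegrable (fun z hz => ?_)
        (fun z hz u _ hzu hden t ht => mobius_path_mem_ball
          (by have := hR1 n; simp only [R]; linarith) hz hzu hden ht) hH hHt
      refine Metric.closedBall_subset_closedBall' ?_
      rw [Metric.mem_ball] at hz
      linarith
    have hU : ⋃ n, Metric.ball (0 : ℂ) (R n) ×ˢ Metric.ball (0 : ℂ) (R n) =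
        curvSpace (-1) ×ˢ curvSpace (-1) := by
      rw [curvSpace_neg_one]
      refine subset_antisymm (iUnion_subset fun n => ?_) fun x hx => ?_
      · have : R n ≤ 1 := by have := hR1 n; simp only [R]; linarith
        exact prod_mono (Metric.ball_subset_ball this) (Metric.ball_subset_ball this)
      · have hlim : Tendsto R atTop (𝓝 1) := by
          simpa [R] using (tendsto_one_div_add_atTop_nhds_zero_nat (𝕜 := ℝ)).const_sub 1
        have h1 := mem_ball_zero_iff.1 hx.1
        have h2 := mem_ball_zero_iff.1 hx.2
        obtain ⟨n, hn1, hn2⟩ := ((hlim.eventually_const_lt h1).and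
          (hlim.eventually_const_lt h2)).exists
        exact mem_iUnion.2 ⟨n, mem_ball_zero_iff.2 hn1, mem_ball_zero_iff.2 hn2⟩
    have hae : ∀ᵐ x ∂((curvArea (-1)).prod (curvArea (-1))),
        x ∈ curvSpace (-1) ×ˢ curvSpace (-1) := by
      filter_upwards [Measure.quasiMeasurePreserving_fst.ae (ae_mem_curvSpace (-1)),
        Measure.quasiMeasurePreserving_snd.ae (ae_mem_curvSpace (-1))] with x h1 h2
      exact ⟨h1, h2⟩
    rw [← Measure.restrict_eq_self_of_ae_mem hae, ← hU, setLIntegral_iUnion_of_directed]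
    · exact iSup_le hbound
    · exact Monotone.directed_le fun n k hnk => prod_mono (Metric.ball_subset_ball (hRm hnk))
        (Metric.ball_subset_ball (hRm hnk))

/-! ### Radial integrals in polar coordinates. -/

lemma lintegral_comp_norm_complex {F : ℝ → ℝ≥0∞} (hF : Measurable F) :
    ∫⁻ u : ℂ, F ‖u‖ =
      ENNReal.ofReal Real.pi * ∫⁻ r in Ioi (0 : ℝ), ENNReal.ofReal (2 * r) * F r := by
  have hm : Measurable fun r : ℝ => ENNReal.ofReal r * F |r| := by
    have : Measurable fun r : ℝ => F |r| := hF.comp measurable_norm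
    fun_prop
  rw [← Complex.lintegral_comp_polarCoord_symm]
  simp_rw [Complex.norm_polarCoord_symm, smul_eq_mul]
  rw [polarCoord_target, Measure.volume_eq_prod, ← Measure.prod_restrict]
  have h := lintegral_prod_mul (μ := volume.restrict (Ioi (0 : ℝ)))
    (ν := volume.restrict (Ioo (-Real.pi) Real.pi)) hm.aemeasurable
    (aemeasurable_const (b := (1 : ℝ≥0∞)))
  simp only [mul_one, lintegral_const, one_mul, Measure.restrict_apply MeasurableSet.univ,
    univ_inter, Real.volume_Ioo] at h
  rw [h, mul_comm, show Real.pi - -Real.pi = Real.pi * 2 by ring,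
    ENNReal.ofReal_mul Real.pi_pos.le, mul_assoc, ← lintegral_const_mul _ hm]
  congr 1
  refine setLIntegral_congr_fun measurableSet_Ioi fun r hr => ?_
  rw [abs_of_pos (mem_Ioi.1 hr), ← mul_assoc, ← ENNReal.ofReal_mul zero_le_two]

lemma setLIntegral_ball_comp_norm {F : ℝ → ℝ≥0∞} (hF : Measurable F) :
    ∫⁻ u in Metric.ball (0 : ℂ) 1, F ‖u‖ =
      ENNReal.ofReal Real.pi * ∫⁻ r in Ioo (0 : ℝ) 1, ENNReal.ofReal (2 * r) * F r := by
  have h : ∀ u : ℂ, (Metric.ball (0 : ℂ) 1).indicator (fun u => F ‖u‖) u =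
      (Iio (1 : ℝ)).indicator F ‖u‖ := fun u => by
    by_cases hu : ‖u‖ < 1
    · rw [indicator_of_mem (mem_ball_zero_iff.2 hu), indicator_of_mem (mem_Iio.2 hu)]
    · rw [indicator_of_notMem (mt mem_ball_zero_iff.1 hu), indicator_of_notMem (mt mem_Iio.1 hu)]
  rw [← lintegral_indicator measurableSet_ball]
  simp_rw [h]
  rw [lintegral_comp_norm_complex (hF.indicator measurableSet_Iio), ← Ioi_inter_Iio, inter_comm,
    ← Measure.restrict_restrict
    measurableSet_Iio, ← lintegral_indicator measurableSet_Iio]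
  congr 1
  refine lintegral_congr fun r => ?_
  simp only [indicator_apply]
  split_ifs <;> simp

/-- Integrability comes for free from the sign of the derivative. This admits integrands that are
singular at an endpoint, such as `(1 - r²) ^ (a - 1)` at `r = 1`. -/
lemma setLIntegral_Ioo_deriv {A A' : ℝ → ℝ} {a b : ℝ} (hab : a ≤ b)
    (hc : ContinuousOn A (Icc a b)) (hd : ∀ x ∈ Ioo a b, HasDerivAt A (A' x) x)
    (h0 : ∀ x ∈ Ioo a b, 0 ≤ A' x) :
    ∫⁻ x in Ioo a b, ENNReal.ofReal (A' x) = ENNReal.ofReal (A b - A a) := by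
  have hi := intervalIntegral.integrableOn_deriv_of_nonneg hc hd h0
  rw [← intervalIntegral.integral_eq_sub_of_hasDerivAt_of_le hab hc hd
    ((intervalIntegrable_iff_integrableOn_Ioc_of_le hab).2 hi),
    intervalIntegral.integral_of_le hab, integral_Ioc_eq_integral_Ioo,
    ofReal_integral_eq_lintegral_ofReal (hi.mono_set Ioo_subset_Ioc_self)]
  exact (ae_restrict_iff' measurableSet_Ioo).2 (ae_of_all _ h0)

lemma setLIntegral_Ioi_deriv {A A' : ℝ → ℝ} {a l : ℝ} (hd : ∀ x ∈ Ici a, HasDerivAt A (A' x) x)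
    (h0 : ∀ x ∈ Ioi a, 0 ≤ A' x) (hl : Tendsto A atTop (𝓝 l)) :
    ∫⁻ x in Ioi a, ENNReal.ofReal (A' x) = ENNReal.ofReal (l - A a) := by
  rw [← integral_Ioi_of_hasDerivAt_of_nonneg' hd h0 hl,
    ofReal_integral_eq_lintegral_ofReal (integrableOn_Ioi_deriv_of_nonneg' hd h0 hl)]
  exact (ae_restrict_iff' measurableSet_Ioi).2 (ae_of_all _ h0)

lemma lintegral_exp_neg_norm_sq {a : ℝ} (ha : 0 < a) :
    ∫⁻ u : ℂ, ENNReal.ofReal (Real.exp (-a * ‖u‖ ^ 2)) = ENNReal.ofReal (Real.pi / a) := by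
  have hd : ∀ r ∈ Ici (0 : ℝ), HasDerivAt (fun r => -(Real.exp (-a * r ^ 2) / a))
      (2 * r * Real.exp (-a * r ^ 2)) r := fun r _ => by
    have h1 : HasDerivAt (fun r : ℝ => -a * r ^ 2) (-a * (2 * r)) r := by
      simpa using (hasDerivAt_pow 2 r).const_mul (-a)
    refine (h1.exp.div_const a).neg.congr_deriv ?_
    field_simp
  have hl : Tendsto (fun r : ℝ => -(Real.exp (-a * r ^ 2) / a)) atTop (𝓝 0) := by
    have h1 : Tendsto (fun r : ℝ => -a * r ^ 2) atTop atBot :=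
      (tendsto_pow_atTop two_ne_zero).const_mul_atTop_of_neg (neg_lt_zero.2 ha)
    simpa using ((Real.tendsto_exp_atBot.comp h1).div_const a).neg
  have key := setLIntegral_Ioi_deriv hd (fun r hr => by have : (0 : ℝ) < r := hr; positivity) hl
  rw [lintegral_comp_norm_complex (F := fun r => ENNReal.ofReal (Real.exp (-a * r ^ 2)))
    (by fun_prop)]
  simp_rw [← ENNReal.ofReal_mul' (Real.exp_pos _).le]
  rw [key, ← ENNReal.ofReal_mul Real.pi_pos.le]
  congr 1; simp; ring

lemma lintegral_one_add_norm_sq_rpow {a : ℝ} (ha : 0 < a) :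
    ∫⁻ u : ℂ, ENNReal.ofReal ((1 + ‖u‖ ^ 2) ^ (-(a + 1))) = ENNReal.ofReal (Real.pi / a) := by
  have hd : ∀ r ∈ Ici (0 : ℝ), HasDerivAt (fun r : ℝ => -((1 + r ^ 2) ^ (-a) / a))
      (2 * r * (1 + r ^ 2) ^ (-(a + 1))) r := fun r _ => by
    have h1 : HasDerivAt (fun r : ℝ => 1 + r ^ 2) (2 * r) r := by
      simpa using (hasDerivAt_pow 2 r).const_add 1
    have hp : (1 + r ^ 2) ≠ 0 := by positivity
    refine ((h1.rpow_const (p := -a) (Or.inl hp)).div_const a).neg.congr_deriv ?_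
    rw [show -a - 1 = -(a + 1) by ring]
    field_simp
  have hl : Tendsto (fun r : ℝ => -((1 + r ^ 2) ^ (-a) / a)) atTop (𝓝 0) := by
    have h1 : Tendsto (fun r : ℝ => 1 + r ^ 2) atTop atTop :=
      tendsto_atTop_add_const_left _ _ (tendsto_pow_atTop two_ne_zero)
    simpa using (((tendsto_rpow_neg_atTop ha).comp h1).div_const a).neg
  have key := setLIntegral_Ioi_deriv hd (fun r hr => by have : (0 : ℝ) < r := hr; positivity) hl
  rw [lintegral_comp_norm_complex (F := fun r => ENNReal.ofReal ((1 + r ^ 2) ^ (-(a + 1))))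
    (by fun_prop)]
  have hnn : ∀ r : ℝ, 0 ≤ (1 + r ^ 2) ^ (-(a + 1)) := fun r => by positivity
  simp_rw [← ENNReal.ofReal_mul' (hnn _)]
  rw [key, ← ENNReal.ofReal_mul Real.pi_pos.le]
  congr 1; simp; ring

lemma setLIntegral_ball_one_sub_norm_sq_rpow {a : ℝ} (ha : 0 < a) :
    ∫⁻ u in Metric.ball (0 : ℂ) 1, ENNReal.ofReal ((1 - ‖u‖ ^ 2) ^ (a - 1)) =
      ENNReal.ofReal (Real.pi / a) := by
  have hpos : ∀ r ∈ Ioo (0 : ℝ) 1, 0 < 1 - r ^ 2 := fun r hr => by nlinarith [hr.1, hr.2]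
  have hd : ∀ r ∈ Ioo (0 : ℝ) 1, HasDerivAt (fun r : ℝ => -((1 - r ^ 2) ^ a / a))
      (2 * r * (1 - r ^ 2) ^ (a - 1)) r := fun r hr => by
    have h1 : HasDerivAt (fun r : ℝ => 1 - r ^ 2) (-(2 * r)) r := by
      simpa using (hasDerivAt_pow 2 r).const_sub 1
    refine ((h1.rpow_const (p := a) (Or.inl (hpos r hr).ne')).div_const a).neg.congr_deriv ?_
    field_simp
  have hc : ContinuousOn (fun r : ℝ => -((1 - r ^ 2) ^ a / a)) (Icc 0 1) := by
    have : Continuous fun r : ℝ => (1 - r ^ 2) ^ a :=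
      (by fun_prop : Continuous fun r : ℝ => 1 - r ^ 2).rpow_const fun _ => Or.inr ha.le
    exact (this.div_const a).neg.continuousOn
  have key := setLIntegral_Ioo_deriv zero_le_one hc hd fun r hr =>
    mul_nonneg (by linarith [hr.1]) (Real.rpow_nonneg (hpos r hr).le _)
  rw [setLIntegral_ball_comp_norm (F := fun r => ENNReal.ofReal ((1 - r ^ 2) ^ (a - 1)))
    (by fun_prop)]
  have e : ∫⁻ r in Ioo (0 : ℝ) 1, ENNReal.ofReal (2 * r) * ENNReal.ofReal ((1 - r ^ 2) ^ (a - 1)) =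
      ∫⁻ r in Ioo (0 : ℝ) 1, ENNReal.ofReal (2 * r * (1 - r ^ 2) ^ (a - 1)) :=
    setLIntegral_congr_fun measurableSet_Ioo fun r hr =>
      (ENNReal.ofReal_mul (by linarith [hr.1])).symm
  rw [e, key, ← ENNReal.ofReal_mul Real.pi_pos.le]
  congr 1
  simp [Real.zero_rpow ha.ne']; ring

lemma radialLength_le_of_nonneg {c r : ℝ} (hc : 0 ≤ c) (hr : 0 ≤ r) :
    radialLength c r ≤ ENNReal.ofReal r := by
  calc radialLength c r ≤ ∫⁻ _ in Icc (0 : ℝ) 1, ENNReal.ofReal r := by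
        refine lintegral_mono fun t => ENNReal.ofReal_le_ofReal (div_le_self hr ?_)
        have : 0 ≤ c * (t * r) ^ 2 := by positivity
        linarith
    _ = _ := by simp

/-- The length is `artanh r`, and a power bound suffices. With `x = 1 - (t r)²`, split `x⁻¹` into
the powers `-1/4` and `-3/4`, and use `x ≥ 1 - r²` in the first and `x ≥ 1 - t` in the second.
Squaring then costs only `(1 - r²) ^ (-1/2)`, which the profile can absorb. -/
lemma radialLength_neg_one_le {r : ℝ} (hr : 0 ≤ r) (hr1 : r < 1) :
    radialLength (-1) r ≤ ENNReal.ofReal (4 * r * (1 - r ^ 2) ^ (-(1 / 4) : ℝ)) := by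
  have hr2 : 0 < 1 - r ^ 2 := by nlinarith
  have hint : ∫⁻ t in Ioo (0 : ℝ) 1, ENNReal.ofReal ((1 - t) ^ (-(3 / 4) : ℝ)) =
      ENNReal.ofReal 4 := by
    have key := setLIntegral_Ioo_deriv (A := fun t => -4 * (1 - t) ^ (1 / 4 : ℝ))
      (A' := fun t => (1 - t) ^ (-(3 / 4) : ℝ)) zero_le_one ?_ ?_ ?_
    · rw [key]; congr 1; norm_num
    · have : Continuous fun t : ℝ => (1 - t) ^ (1 / 4 : ℝ) :=
        (by fun_prop : Continuous fun t : ℝ => 1 - t).rpow_const fun _ => Or.inr (by norm_num)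
      exact (this.const_mul _).continuousOn
    · intro t ht
      have h1 : HasDerivAt (fun t : ℝ => 1 - t) (-1) t := by
        simpa using (hasDerivAt_id t).const_sub 1
      refine ((h1.rpow_const (p := 1 / 4) (Or.inl (sub_pos.2 ht.2).ne')).const_mul
        (-4)).congr_deriv ?_
      rw [show (1 / 4 : ℝ) - 1 = -(3 / 4) by norm_num]; ring
    · intro t ht; exact Real.rpow_nonneg (sub_pos.2 ht.2).le _
  have hK : 0 ≤ r * (1 - r ^ 2) ^ (-(1 / 4) : ℝ) := by positivity
  calc radialLength (-1) r = ∫⁻ t in Ioo (0 : ℝ) 1, radialSpeed (-1) t r :=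
        setLIntegral_congr Ioo_ae_eq_Icc.symm
    _ ≤ ∫⁻ t in Ioo (0 : ℝ) 1, ENNReal.ofReal (r * (1 - r ^ 2) ^ (-(1 / 4) : ℝ)) *
          ENNReal.ofReal ((1 - t) ^ (-(3 / 4) : ℝ)) := by
        refine setLIntegral_mono' measurableSet_Ioo fun t ht => ?_
        rw [← ENNReal.ofReal_mul hK]
        refine ENNReal.ofReal_le_ofReal ?_
        rw [div_eq_mul_inv, mul_assoc]
        refine mul_le_mul_of_nonneg_left ?_ hr
        have ht1 : 0 < 1 - t := sub_pos.2 ht.2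
        have htr : t * r ≤ t := mul_le_of_le_one_right ht.1.le hr1.le
        have hx1 : 1 - r ^ 2 ≤ 1 + -1 * (t * r) ^ 2 := by
          have : t * r ≤ r := mul_le_of_le_one_left hr ht.2.le
          nlinarith [mul_nonneg ht.1.le hr]
        have hx2 : 1 - t ≤ 1 + -1 * (t * r) ^ 2 := by
          nlinarith [mul_nonneg ht.1.le hr, ht.1, ht.2]
        have hx : 0 < 1 + -1 * (t * r) ^ 2 := hr2.trans_le hx1
        calc (1 + -1 * (t * r) ^ 2)⁻¹ = (1 + -1 * (t * r) ^ 2) ^ (-(1 / 4) : ℝ) *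
              (1 + -1 * (t * r) ^ 2) ^ (-(3 / 4) : ℝ) := by
              rw [← Real.rpow_add hx, ← Real.rpow_neg_one]; norm_num
          _ ≤ _ := mul_le_mul (Real.rpow_le_rpow_of_nonpos hr2 hx1 (by norm_num))
              (Real.rpow_le_rpow_of_nonpos ht1 hx2 (by norm_num)) (by positivity)
              (by positivity)
    _ = _ := by
        rw [lintegral_const_mul' _ _ ENNReal.ofReal_ne_top, hint, ← ENNReal.ofReal_mul hK]
        congr 1; ring

lemma lintegral_curvArea_zero (F : ℂ → ℝ≥0∞) : ∫⁻ z, F z ∂(curvArea 0) = ∫⁻ z, F z := by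
  rw [lintegral_curvArea, curvSpace_eq_univ le_rfl, Measure.restrict_univ]
  simp

lemma lintegral_curvArea_one (F : ℂ → ℝ≥0∞) : ∫⁻ z, F z ∂(curvArea 1) =
    ∫⁻ z, ENNReal.ofReal ((1 + ‖z‖ ^ 2) ^ (-2 : ℝ)) * F z := by
  rw [lintegral_curvArea, curvSpace_eq_univ zero_le_one, Measure.restrict_univ]
  refine lintegral_congr fun z => ?_
  congr 2
  rw [Real.rpow_neg (by positivity), one_mul, one_div, inv_pow]
  norm_cast

lemma lintegral_curvArea_neg_one (F : ℂ → ℝ≥0∞) : ∫⁻ z, F z ∂(curvArea (-1)) =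
    ∫⁻ z in Metric.ball 0 1, ENNReal.ofReal ((1 - ‖z‖ ^ 2) ^ (-2 : ℝ)) * F z := by
  rw [lintegral_curvArea, curvSpace_neg_one]
  refine setLIntegral_congr_fun measurableSet_ball fun z hz => ?_
  have : 0 < 1 - ‖z‖ ^ 2 := by
    rw [mem_ball_zero_iff] at hz; nlinarith [norm_nonneg z]
  congr 2
  rw [Real.rpow_neg this.le, one_div, inv_pow, neg_one_mul, ← sub_eq_add_neg]
  norm_cast

/-! ### Mass and second moment of the squared kernel. -/

/-- The squared modulus of the normalised kernel, as a function of the coordinate distance. -/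
def InvModel.profile : InvModel → ℝ → ℝ → ℝ
  | .planar, ρ, r => Real.exp (-ρ * r ^ 2)
  | .spherical, ρ, r => (1 + r ^ 2) ^ (-(ρ - 1))
  | .hyperbolic, ρ, r => (1 - r ^ 2) ^ (ρ + 1)

/-- A quarter of the curvature. -/
def InvModel.curv : InvModel → ℝ
  | .planar => 0
  | .spherical => 1
  | .hyperbolic => -1

lemma InvModel.curv_cases (m : InvModel) : 0 ≤ m.curv ∨ m.curv = -1 := by
  cases m <;> simp [InvModel.curv]

lemma InvModel.measurable_profile (m : InvModel) (ρ : ℝ) : Measurable (m.profile ρ) := by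
  cases m <;> unfold InvModel.profile <;> fun_prop

/-- This is the reproducing property of the kernel at the origin; invariance carries it to every
other point. -/
lemma InvModel.lintegral_profile (m : InvModel) {ρ : ℝ} (hρ : 0 < ρ) :
    ∫⁻ u, ENNReal.ofReal (m.profile ρ ‖u‖) ∂(curvArea m.curv) =
      ENNReal.ofReal (Real.pi / ρ) := by
  cases m
  · rw [InvModel.curv, lintegral_curvArea_zero]
    exact lintegral_exp_neg_norm_sq hρ
  · rw [InvModel.curv, lintegral_curvArea_one, ← lintegral_one_add_norm_sq_rpow hρ]
    refine lintegral_congr fun u => ?_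
    have : 0 < 1 + ‖u‖ ^ 2 := by positivity
    rw [← ENNReal.ofReal_mul (by positivity)]
    simp only [InvModel.profile]
    rw [← Real.rpow_add this]
    congr 2; ring
  · rw [InvModel.curv, lintegral_curvArea_neg_one, ← setLIntegral_ball_one_sub_norm_sq_rpow hρ]
    refine setLIntegral_congr_fun measurableSet_ball fun u hu => ?_
    have : 0 < 1 - ‖u‖ ^ 2 := by
      rw [mem_ball_zero_iff] at hu; nlinarith [norm_nonneg u]
    rw [← ENNReal.ofReal_mul (by positivity)]
    simp only [InvModel.profile]
    rw [← Real.rpow_add this]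
    congr 2; ring

/-- About half of the decay of the profile absorbs the squared length at the price of a factor of
order `1/ρ`, and the other half integrates to order `1/ρ`. -/
lemma InvModel.lintegral_radialLength_sq_mul_profile_le (m : InvModel) {ρ : ℝ} (hρ : 1 < ρ)
    (hm : m.Admissible ρ) :
    ∫⁻ u, radialLength m.curv ‖u‖ ^ 2 * ENNReal.ofReal (m.profile ρ ‖u‖) ∂(curvArea m.curv) ≤
      ENNReal.ofReal (256 * Real.pi / ρ ^ 2) := by
  have hπ := Real.pi_pos
  cases m
  · rw [InvModel.curv, lintegral_curvArea_zero]
    calc _ ≤ ∫⁻ u : ℂ, ENNReal.ofReal (2 / ρ) *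
          ENNReal.ofReal (Real.exp (-(ρ / 2) * ‖u‖ ^ 2)) := by
          refine lintegral_mono fun u => ?_
          refine (mul_le_mul_left (pow_le_pow_left' (radialLength_le_of_nonneg le_rfl
            (norm_nonneg u)) 2) _).trans ?_
          rw [← ENNReal.ofReal_pow (norm_nonneg u), ← ENNReal.ofReal_mul (by positivity),
            ← ENNReal.ofReal_mul (by positivity)]
          refine ENNReal.ofReal_le_ofReal ?_
          simp only [InvModel.profile]
          have h1 := Real.add_one_le_exp (ρ / 2 * ‖u‖ ^ 2)
          have h2 : Real.exp (-(ρ / 2) * ‖u‖ ^ 2) =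
              Real.exp (ρ / 2 * ‖u‖ ^ 2) * Real.exp (-ρ * ‖u‖ ^ 2) := by
            rw [← Real.exp_add]; congr 1; ring
          rw [h2, ← mul_assoc]
          refine mul_le_mul_of_nonneg_right ?_ (Real.exp_pos _).le
          rw [div_mul_eq_mul_div, le_div_iff₀ (by linarith)]
          linarith
      _ = ENNReal.ofReal (2 / ρ * (Real.pi / (ρ / 2))) := by
          rw [lintegral_const_mul' _ _ ENNReal.ofReal_ne_top,
            lintegral_exp_neg_norm_sq (by linarith), ← ENNReal.ofReal_mul (by positivity)]
      _ ≤ _ := by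
          refine ENNReal.ofReal_le_ofReal ?_
          rw [show 2 / ρ * (Real.pi / (ρ / 2)) = 4 * Real.pi / ρ ^ 2 by field_simp; ring]
          gcongr; norm_num
  -- Integrality turns `ρ > 1` into `ρ ≥ 2`, so that Bernoulli's inequality applies with exponent `ρ
  -- / 2`.
  · have hρ2 : 2 ≤ ρ := by
      obtain ⟨n, _, rfl⟩ := hm
      exact_mod_cast (by exact_mod_cast hρ : 1 < n)
    rw [InvModel.curv, lintegral_curvArea_one]
    calc _ ≤ ∫⁻ u : ℂ, ENNReal.ofReal (2 / ρ) *
          ENNReal.ofReal ((1 + ‖u‖ ^ 2) ^ (-(ρ / 2 + 1))) := by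
          refine lintegral_mono fun u => ?_
          have hp : 0 < 1 + ‖u‖ ^ 2 := by positivity
          refine (mul_le_mul_right (mul_le_mul_left (pow_le_pow_left' (radialLength_le_of_nonneg
            zero_le_one (norm_nonneg u)) 2) _) _).trans ?_
          rw [← ENNReal.ofReal_pow (norm_nonneg u), ← ENNReal.ofReal_mul (by positivity),
            ← ENNReal.ofReal_mul (by positivity), ← ENNReal.ofReal_mul (by positivity)]
          refine ENNReal.ofReal_le_ofReal ?_
          simp only [InvModel.profile]
          have h1 := one_add_mul_self_le_rpow_one_add (s := ‖u‖ ^ 2) (by linarith [sq_nonneg ‖u‖])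
            (p := ρ / 2) (by linarith)
          have h2 : (1 + ‖u‖ ^ 2) ^ (-(ρ / 2 + 1)) = (1 + ‖u‖ ^ 2) ^ (ρ / 2) *
              ((1 + ‖u‖ ^ 2) ^ (-2 : ℝ) * (1 + ‖u‖ ^ 2) ^ (-(ρ - 1))) := by
            rw [← Real.rpow_add hp, ← Real.rpow_add hp]; congr 1; ring
          rw [h2, ← mul_assoc (2 / ρ), mul_left_comm]
          refine mul_le_mul_of_nonneg_right ?_ (by positivity)
          rw [div_mul_eq_mul_div, le_div_iff₀ (by linarith)]
          linarith
      _ = ENNReal.ofReal (2 / ρ * (Real.pi / (ρ / 2))) := by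
          rw [lintegral_const_mul' _ _ ENNReal.ofReal_ne_top,
            lintegral_one_add_norm_sq_rpow (by linarith), ← ENNReal.ofReal_mul (by positivity)]
      _ ≤ _ := by
          refine ENNReal.ofReal_le_ofReal ?_
          rw [show 2 / ρ * (Real.pi / (ρ / 2)) = 4 * Real.pi / ρ ^ 2 by field_simp; ring]
          gcongr; norm_num
  · rw [InvModel.curv, lintegral_curvArea_neg_one]
    -- Area, squared length and profile contribute `-2`, `-1/2` and `ρ + 1` to the exponent of `1 -
    -- r²`. The sum is `ρ - 3/2 = a + (a - 1)`: the power `a` absorbs `r²`, and the power `a - 1` is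
    -- integrated.
    have ha : 0 < (ρ - 1 / 2) / 2 := by linarith
    set a := (ρ - 1 / 2) / 2 with ha_def
    calc _ ≤ ∫⁻ u : ℂ in Metric.ball 0 1, ENNReal.ofReal (16 / a) *
          ENNReal.ofReal ((1 - ‖u‖ ^ 2) ^ (a - 1)) := by
          refine setLIntegral_mono' measurableSet_ball fun u hu => ?_
          rw [mem_ball_zero_iff] at hu
          have hp : 0 < 1 - ‖u‖ ^ 2 := by nlinarith [norm_nonneg u]
          refine (mul_le_mul_right (mul_le_mul_left (pow_le_pow_left' (radialLength_neg_one_le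
            (norm_nonneg u) hu) 2) _) _).trans ?_
          rw [← ENNReal.ofReal_pow (by positivity), ← ENNReal.ofReal_mul (by positivity),
            ← ENNReal.ofReal_mul (by positivity), ← ENNReal.ofReal_mul (by positivity)]
          refine ENNReal.ofReal_le_ofReal ?_
          simp only [InvModel.profile]
          have h1 : (1 - ‖u‖ ^ 2) ^ a ≤ Real.exp (-(a * ‖u‖ ^ 2)) := by
            rw [Real.rpow_def_of_pos hp]
            refine Real.exp_le_exp.2 ?_
            nlinarith [Real.log_le_sub_one_of_pos hp]
          have h3 : a * ‖u‖ ^ 2 * Real.exp (-(a * ‖u‖ ^ 2)) ≤ 1 := by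
            rw [Real.exp_neg, ← div_eq_mul_inv, div_le_one (Real.exp_pos _)]
            linarith [Real.add_one_le_exp (a * ‖u‖ ^ 2)]
          have h4 : ‖u‖ ^ 2 * (1 - ‖u‖ ^ 2) ^ a ≤ 1 / a := by
            rw [le_div_iff₀ ha]
            nlinarith [mul_le_mul_of_nonneg_left h1 (by positivity : 0 ≤ a * ‖u‖ ^ 2)]
          have h2 : (1 - ‖u‖ ^ 2) ^ (-2 : ℝ) * ((4 * ‖u‖ * (1 - ‖u‖ ^ 2) ^ (-(1 / 4) : ℝ)) ^ 2 *
              (1 - ‖u‖ ^ 2) ^ (ρ + 1)) =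
              16 * (‖u‖ ^ 2 * (1 - ‖u‖ ^ 2) ^ a) * (1 - ‖u‖ ^ 2) ^ (a - 1) := by
            have e1 : ((1 - ‖u‖ ^ 2) ^ (-(1 / 4) : ℝ)) ^ 2 = (1 - ‖u‖ ^ 2) ^ (-(1 / 2) : ℝ) := by
              rw [← Real.rpow_natCast, ← Real.rpow_mul hp.le]; norm_num
            have e2 : (1 - ‖u‖ ^ 2) ^ (-2 : ℝ) * (1 - ‖u‖ ^ 2) ^ (-(1 / 2) : ℝ) *
                (1 - ‖u‖ ^ 2) ^ (ρ + 1) = (1 - ‖u‖ ^ 2) ^ a * (1 - ‖u‖ ^ 2) ^ (a - 1) := by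
              rw [← Real.rpow_add hp, ← Real.rpow_add hp, ← Real.rpow_add hp]
              congr 1; rw [ha_def]; ring
            rw [mul_pow, e1]
            linear_combination 16 * ‖u‖ ^ 2 * e2
          rw [h2, show 16 / a = 16 * (1 / a) by ring]
          gcongr
      _ = ENNReal.ofReal (16 / a * (Real.pi / a)) := by
          rw [lintegral_const_mul' _ _ ENNReal.ofReal_ne_top,
            setLIntegral_ball_one_sub_norm_sq_rpow ha, ← ENNReal.ofReal_mul (by positivity)]
      _ ≤ _ := by
          refine ENNReal.ofReal_le_ofReal ?_
          -- This comparison uses `ρ > 1` and turns the `16` of the squared length bound into `256`.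
          have h4 : ρ / 4 ≤ a := by rw [ha_def]; linarith
          have h5 : (ρ / 4) ^ 2 ≤ a ^ 2 := by gcongr
          calc 16 / a * (Real.pi / a) = 16 * Real.pi / a ^ 2 := by field_simp
            _ ≤ 16 * Real.pi / (ρ / 4) ^ 2 := by gcongr
            _ = _ := by field_simp; ring

/-! ### The three kernels in invariant form. -/

namespace InvModel

lemma space_eq (m : InvModel) : m.space = curvSpace m.curv := by
  cases m
  · exact (curvSpace_eq_univ le_rfl).symm
  · exact (curvSpace_eq_univ zero_le_one).symm
  · exact curvSpace_neg_one.symm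

lemma conformalFactor_eq (m : InvModel) (z : ℂ) :
    m.conformalFactor z = 1 / (1 + m.curv * ‖z‖ ^ 2) := by
  cases m <;> simp [conformalFactor, curv, sub_eq_add_neg]

lemma invMeasure_eq (m : InvModel) : m.invMeasure = curvArea m.curv := by
  unfold invMeasure curvArea
  simp_rw [conformalFactor_eq, space_eq]

lemma measurable_refDensity (m : InvModel) (ρ : ℝ) : Measurable (m.refDensity ρ) := by
  cases m <;> unfold refDensity <;> fun_prop

lemma refDensity_nonneg (m : InvModel) {ρ : ℝ} (hρ : 0 < ρ) {z : ℂ} (hz : z ∈ curvSpace m.curv) :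
    0 ≤ m.refDensity ρ z := by
  have hπ := Real.pi_pos
  cases m
  · simp only [refDensity]; positivity
  · simp only [refDensity]; positivity
  · have h : 0 < 1 - ‖z‖ ^ 2 := by
      have h := mem_curvSpace.1 hz
      simpa [curv, sub_eq_add_neg] using h
    simp only [refDensity]; positivity

lemma profile_nonneg (m : InvModel) (ρ : ℝ) {r : ℝ} (hr : 0 ≤ 1 + m.curv * r ^ 2) :
    0 ≤ m.profile ρ r := by
  cases m
  · simp only [profile]; positivity
  · simp only [profile]; positivity
  · have h : 0 ≤ 1 - r ^ 2 := by simpa [curv, sub_eq_add_neg] using hr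
    simp only [profile]; positivity

/-- Cauchy–Schwarz for the kernel. It makes the two-point determinant non-negative, so that
`ENNReal.ofReal` does not truncate it. -/
lemma profile_le_one (m : InvModel) {ρ : ℝ} (hρ : 1 < ρ) {r : ℝ}
    (hr : 0 ≤ 1 + m.curv * r ^ 2) : m.profile ρ r ≤ 1 := by
  cases m
  · simp only [profile]
    exact Real.exp_le_one_iff.2 (by nlinarith [sq_nonneg r])
  · exact Real.rpow_le_one_of_one_le_of_nonpos (by nlinarith [sq_nonneg r]) (by linarith)
  · have h : 0 ≤ 1 - r ^ 2 := by simpa [curv, sub_eq_add_neg] using hr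
    exact Real.rpow_le_one h (by nlinarith [sq_nonneg r]) (by linarith)

lemma kernel_self (m : InvModel) {ρ : ℝ} {z : ℂ} (hz : z ∈ curvSpace m.curv) :
    (m.kernel ρ z z).im = 0 ∧
      (m.kernel ρ z z).re * m.refDensity ρ z =
        ρ / Real.pi * (1 / (1 + m.curv * ‖z‖ ^ 2)) ^ 2 := by
  have hzz : z * conj z = ((‖z‖ ^ 2 : ℝ) : ℂ) := by rw [mul_comm, conj_mul_self_ofReal]
  cases m
  · simp only [kernel, hzz, refDensity, curv]
    rw [← Complex.ofReal_mul, ← Complex.ofReal_exp, Complex.ofReal_re, Complex.ofReal_im]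
    refine ⟨rfl, ?_⟩
    rw [mul_left_comm, ← Real.exp_add]
    simp
  · have hp : 0 < 1 + ‖z‖ ^ 2 := by positivity
    have e : (1 + z * conj z) ^ ((ρ : ℂ) - 1) = (((1 + ‖z‖ ^ 2) ^ (ρ - 1) : ℝ) : ℂ) := by
      rw [hzz, Complex.ofReal_cpow hp.le]; push_cast; rfl
    simp only [kernel, refDensity, curv, e, Complex.ofReal_re, Complex.ofReal_im]
    refine ⟨trivial, ?_⟩
    rw [mul_left_comm, ← Real.rpow_add hp, show ρ - 1 + -(ρ + 1) = -2 by ring,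
      Real.rpow_neg hp.le, one_mul, one_div, inv_pow]
    norm_cast
  · have hp : 0 < 1 - ‖z‖ ^ 2 := by
      have h := mem_curvSpace.1 hz
      simpa [curv, sub_eq_add_neg] using h
    have e : 1 / (1 - z * conj z) ^ ((ρ : ℂ) + 1) = (((1 - ‖z‖ ^ 2) ^ (-(ρ + 1)) : ℝ) : ℂ) := by
      rw [hzz, Real.rpow_neg hp.le, Complex.ofReal_inv, Complex.ofReal_cpow hp.le, one_div]
      push_cast; rfl
    simp only [kernel, refDensity, curv, e, Complex.ofReal_re, Complex.ofReal_im]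
    refine ⟨trivial, ?_⟩
    rw [mul_left_comm, ← Real.rpow_add hp, show -(ρ + 1) + (ρ - 1) = -2 by ring,
      Real.rpow_neg hp.le, one_div, inv_pow, neg_one_mul, ← sub_eq_add_neg]
    norm_cast

/-- The branch of the power matters here. On the sphere the exponent is a natural number, and in the
disk `1 - z w̄` has positive real part, off the cut. -/
lemma kernel_swap (m : InvModel) {ρ : ℝ} (hρ : m.Admissible ρ) {z w : ℂ}
    (hz : z ∈ curvSpace m.curv) (hw : w ∈ curvSpace m.curv) :
    m.kernel ρ w z = conj (m.kernel ρ z w) := by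
  cases m
  · simp [kernel, ← Complex.exp_conj, mul_comm]
  · obtain ⟨n, hn, rfl⟩ := hρ
    have e : ((n : ℝ) : ℂ) - 1 = ((n - 1 : ℕ) : ℂ) := by
      rw [Nat.cast_sub hn]; simp
    simp only [kernel, e, Complex.cpow_natCast]
    simp [mul_comm]
  · rw [curv, curvSpace_neg_one, mem_ball_zero_iff] at hz hw
    have hre : 0 < (1 - z * conj w).re := by
      have h1 : ‖z * conj w‖ < 1 := by
        rw [norm_mul, Complex.norm_conj]; nlinarith [norm_nonneg z, norm_nonneg w]
      have h2 := (Complex.re_le_norm (z * conj w)).trans_lt h1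
      rw [Complex.sub_re, Complex.one_re]; linarith
    have harg : (1 - z * conj w).arg ≠ Real.pi := by
      intro h
      have := (Complex.arg_eq_pi_iff.1 h).1
      linarith
    have h := Complex.conj_cpow (1 - z * conj w) ((ρ : ℂ) + 1) harg
    have e1 : conj ((ρ : ℂ) + 1) = (ρ : ℂ) + 1 := by simp
    have e2 : conj (1 - z * conj w) = 1 - w * conj z := by simp [mul_comm]
    simp only [kernel]
    rw [map_div₀, map_one]
    rw [e1, e2] at h
    rw [h]

/-- In the curved models this is `one_add_norm_sq_mobius` raised to the exponent of the profile; in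
the plane it is the expansion of `|w - z|²` in the exponential. It makes the truncated pair
correlation a function of the distance. -/
lemma kernel_mul_swap (m : InvModel) {ρ : ℝ} (hρ : m.Admissible ρ) {z w : ℂ}
    (hz : z ∈ curvSpace m.curv) (hw : w ∈ curvSpace m.curv)
    (hden : 1 - m.curv * conj (-z) * w ≠ 0) :
    (m.kernel ρ z w * m.kernel ρ w z).re * (m.refDensity ρ z * m.refDensity ρ w) =
      (ρ / Real.pi) ^ 2 * m.profile ρ ‖mobius m.curv (-z) w‖ *
        ((1 / (1 + m.curv * ‖z‖ ^ 2)) ^ 2 * (1 / (1 + m.curv * ‖w‖ ^ 2)) ^ 2) := by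
  rw [kernel_swap m hρ hz hw, Complex.mul_conj, Complex.ofReal_re, Complex.normSq_eq_norm_sq]
  have hmob := one_add_norm_sq_mobius hden
  rw [norm_neg] at hmob
  have hN : 0 < ‖1 - m.curv * conj (-z) * w‖ := norm_pos_iff.2 hden
  have hz' := mem_curvSpace.1 hz
  have hw' := mem_curvSpace.1 hw
  cases m
  · simp only [kernel, refDensity, profile, curv, Complex.norm_exp]
    have h1 : ‖mobius 0 (-z) w‖ ^ 2 = ‖z‖ ^ 2 + ‖w‖ ^ 2 - 2 * (z * conj w).re := by
      have : mobius 0 (-z) w = w - z := by simp [mobius]; ring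
      rw [this]
      simp only [Complex.sq_norm, Complex.normSq_apply, Complex.sub_re, Complex.sub_im,
        Complex.mul_re, Complex.conj_re, Complex.conj_im]
      ring
    rw [h1, Complex.re_ofReal_mul, ← Real.exp_nat_mul]
    have h2 : Real.exp (-ρ * (‖z‖ ^ 2 + ‖w‖ ^ 2 - 2 * (z * conj w).re)) =
        Real.exp ((2 : ℕ) * (ρ * (z * conj w).re)) * (Real.exp (-ρ * ‖z‖ ^ 2) *
          Real.exp (-ρ * ‖w‖ ^ 2)) := by
      rw [← Real.exp_add, ← Real.exp_add]; congr 1; push_cast; ring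
    rw [h2]
    simp only [zero_mul, add_zero, one_div, inv_one, one_pow, mul_one]
    ring
  · simp only [curv, Complex.ofReal_one, one_mul] at hmob hN hz' hw' ⊢
    have e0 : ‖1 + z * conj w‖ = ‖1 - conj (-z) * w‖ := by
      rw [← Complex.norm_conj]; congr 1; simp
    have e1 : (ρ : ℂ) - 1 = ((ρ - 1 : ℝ) : ℂ) := by push_cast; rfl
    simp only [kernel, refDensity, profile]
    rw [e1, Complex.norm_cpow_real, e0, hmob]
    set a := 1 + ‖z‖ ^ 2
    set b := 1 + ‖w‖ ^ 2
    set N := ‖1 - conj (-z) * w‖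
    have hab := mul_pos hz' hw'
    rw [Real.div_rpow hab.le (by positivity), Real.mul_rpow hz'.le hw'.le,
      ← Real.rpow_natCast N 2, ← Real.rpow_mul hN.le, ← Real.rpow_natCast (N ^ (ρ - 1)) 2,
      ← Real.rpow_mul hN.le,
      show ((2 : ℕ) : ℝ) * -(ρ - 1) = -((ρ - 1) * ((2 : ℕ) : ℝ)) by ring,
      Real.rpow_neg hN.le, div_inv_eq_mul]
    have ha : ∀ x : ℝ, 0 < x → x ^ (-(ρ + 1)) = x ^ (-(ρ - 1)) * (1 / x) ^ 2 := fun x hx => by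
      rw [one_div, inv_pow, ← Real.rpow_natCast x 2, ← Real.rpow_neg hx.le, ← Real.rpow_add hx]
      congr 1; push_cast; ring
    rw [ha a hz', ha b hw']
    ring
  · simp only [curv, Complex.ofReal_neg, Complex.ofReal_one, neg_mul, one_mul,
      sub_neg_eq_add, ← sub_eq_add_neg] at hmob hN hz' hw' ⊢
    have e0 : ‖1 - z * conj w‖ = ‖1 + conj (-z) * w‖ := by
      rw [← Complex.norm_conj]; congr 1; simp [sub_eq_add_neg]
    have e1 : (ρ : ℂ) + 1 = ((ρ + 1 : ℝ) : ℂ) := by push_cast; rfl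
    simp only [kernel, refDensity, profile]
    rw [norm_div, norm_one, e1, Complex.norm_cpow_real, e0, hmob]
    set a := 1 - ‖z‖ ^ 2
    set b := 1 - ‖w‖ ^ 2
    set N := ‖1 + conj (-z) * w‖
    have hab := mul_pos hz' hw'
    rw [Real.div_rpow hab.le (by positivity), Real.mul_rpow hz'.le hw'.le,
      ← Real.rpow_natCast N 2, ← Real.rpow_mul hN.le, div_pow, ← Real.rpow_natCast (N ^ (ρ + 1)) 2,
      ← Real.rpow_mul hN.le, mul_comm ((2 : ℕ) : ℝ)]
    have ha : ∀ x : ℝ, 0 < x → x ^ (ρ - 1) = x ^ (ρ + 1) * (1 / x) ^ 2 := fun x hx => by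
      rw [one_div, inv_pow, ← Real.rpow_natCast x 2, ← Real.rpow_neg hx.le, ← Real.rpow_add hx]
      congr 1; push_cast; ring
    rw [ha a hz', ha b hw']
    field_simp

end InvModel

/-! ### The pair law of the determinantal processes. -/

lemma prod_diagonal_eq_zero {μ ν : Measure ℂ} [SFinite ν] (hν : ν ≪ volume) :
    (μ.prod ν) (diagonal ℂ) = 0 := by
  rw [Measure.prod_apply measurableSet_diagonal]
  have : ∀ x : ℂ, ν (Prod.mk x ⁻¹' diagonal ℂ) = 0 := fun x => by
    have : Prod.mk x ⁻¹' diagonal ℂ = {x} := by ext y; simp [eq_comm]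
    rw [this]
    exact hν (measure_singleton x)
  simp [this]

lemma IsPointProcess.countable {Ω : Type*} [MeasurableSpace Ω] {c : ℝ} (hc : 0 ≤ c ∨ c = -1)
    {Z : Ω → Set ℂ} (hZ : IsPointProcess (curvSpace c) Z) (ω : Ω) : (Z ω).Countable := by
  obtain ⟨K, hK, hU⟩ : ∃ K : ℕ → Set ℂ, (∀ n, IsCompact (K n) ∧ K n ⊆ curvSpace c) ∧
      curvSpace c ⊆ ⋃ n, K n := by
    rcases hc with hc | rfl
    · rw [curvSpace_eq_univ hc]
      exact ⟨fun n => Metric.closedBall 0 n, fun n => ⟨isCompact_closedBall _ _, subset_univ _⟩,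
        (Metric.iUnion_closedBall_nat 0).ge⟩
    · rw [curvSpace_neg_one]
      refine ⟨fun n => Metric.closedBall 0 (1 - 1 / ((n : ℝ) + 1)), fun n =>
        ⟨isCompact_closedBall _ _, Metric.closedBall_subset_ball ?_⟩, fun z hz => ?_⟩
      · have : 0 < 1 / ((n : ℝ) + 1) := by positivity
        linarith
      · rw [mem_ball_zero_iff] at hz
        obtain ⟨n, hn⟩ := exists_nat_one_div_lt (sub_pos.2 hz)
        exact mem_iUnion.2 ⟨n, mem_closedBall_zero_iff.2 (by linarith)⟩
  have h : Z ω ⊆ ⋃ n, K n ∩ Z ω := fun z hz => by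
    rw [← iUnion_inter]
    exact ⟨hU (hZ.subset ω hz), hz⟩
  exact (countable_iUnion fun n => (hZ.locallyFinite ω _ (hK n).1 (hK n).2).countable).mono h

namespace InvModel

/-- The intensity of the determinantal process of the model. -/
def intensity (m : InvModel) (ρ : ℝ) : Measure ℂ := ENNReal.ofReal (ρ / Real.pi) • curvArea m.curv

/-- The squared modulus of the kernel as a measure on pairs. -/
def pairMeasure (m : InvModel) (ρ : ℝ) : Measure (ℂ × ℂ) :=
  ((curvArea m.curv).prod (curvArea m.curv)).withDensity fun x =>
    ENNReal.ofReal ((ρ / Real.pi) ^ 2) * ENNReal.ofReal (m.profile ρ ‖mobius m.curv (-x.1) x.2‖)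

lemma measurable_profile_mobius (m : InvModel) (ρ : ℝ) : Measurable fun x : ℂ × ℂ =>
    ENNReal.ofReal (m.profile ρ ‖mobius m.curv (-x.1) x.2‖) :=
  ((m.measurable_profile ρ).comp ((measurable_mobius _).comp
    (measurable_fst.neg.prodMk measurable_snd)).norm).ennreal_ofReal

lemma lintegral_pairMeasure (m : InvModel) (ρ : ℝ) (F : ℂ × ℂ → ℝ≥0∞) :
    ∫⁻ x, F x ∂(m.pairMeasure ρ) = ENNReal.ofReal ((ρ / Real.pi) ^ 2) *
      ∫⁻ x, F x * ENNReal.ofReal (m.profile ρ ‖mobius m.curv (-x.1) x.2‖)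
        ∂((curvArea m.curv).prod (curvArea m.curv)) := by
  rw [pairMeasure, lintegral_withDensity_eq_lintegral_mul_non_measurable _
    ((m.measurable_profile_mobius ρ).const_mul _)
    (ae_of_all _ fun _ => ENNReal.mul_lt_top ENNReal.ofReal_lt_top ENNReal.ofReal_lt_top),
    ← lintegral_const_mul' _ _ ENNReal.ofReal_ne_top]
  refine lintegral_congr fun x => ?_
  simp only [Pi.mul_apply]
  ring

/-- Translation by `-z` moves the inner integral to the origin, where it equals `π / ρ`. Both
marginals of the pair measure are computed from this. -/
lemma lintegral_intensity_profile (m : InvModel) {ρ : ℝ} (hρ : 0 < ρ) (A : Set ℂ) :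
    ENNReal.ofReal ((ρ / Real.pi) ^ 2) * ∫⁻ z in A, ∫⁻ w,
      ENNReal.ofReal (m.profile ρ ‖mobius m.curv (-z) w‖) ∂(curvArea m.curv) ∂(curvArea m.curv) =
      m.intensity ρ A := by
  have hπ := Real.pi_pos
  have h : ∀ᵐ z ∂((curvArea m.curv).restrict A), ∫⁻ w,
      ENNReal.ofReal (m.profile ρ ‖mobius m.curv (-z) w‖) ∂(curvArea m.curv) =
        ENNReal.ofReal (Real.pi / ρ) := by
    filter_upwards [ae_restrict_of_ae (ae_mem_curvSpace m.curv)] with z hz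
    rw [← m.lintegral_profile hρ]
    exact lintegral_comp_mobius (neg_mem_curvSpace hz) fun w => ENNReal.ofReal (m.profile ρ ‖w‖)
  rw [lintegral_congr_ae h, setLIntegral_const, ← mul_assoc, ← ENNReal.ofReal_mul (by positivity),
    intensity, Measure.smul_apply, smul_eq_mul]
  congr 2
  field_simp

lemma map_fst_pairMeasure (m : InvModel) {ρ : ℝ} (hρ : 0 < ρ) :
    (m.pairMeasure ρ).map Prod.fst = m.intensity ρ := by
  ext A hA
  rw [Measure.map_apply measurable_fst hA, ← lintegral_indicator_one (measurable_fst hA),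
    lintegral_pairMeasure, lintegral_prod, ← m.lintegral_intensity_profile hρ A,
    ← lintegral_indicator hA]
  · congr 1
    refine lintegral_congr fun z => ?_
    by_cases hz : z ∈ A
    · rw [indicator_of_mem hz]
      refine lintegral_congr fun w => ?_
      rw [indicator_of_mem (by exact hz), Pi.one_apply, one_mul]
    · rw [indicator_of_notMem hz]
      refine (lintegral_congr fun w => ?_).trans lintegral_zero
      rw [indicator_of_notMem (by exact hz), zero_mul]
  · exact ((measurable_one.indicator (measurable_fst hA)).mul
      (m.measurable_profile_mobius ρ)).aemeasurable

lemma map_snd_pairMeasure (m : InvModel) {ρ : ℝ} (hρ : 0 < ρ) :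
    (m.pairMeasure ρ).map Prod.snd = m.intensity ρ := by
  ext A hA
  rw [Measure.map_apply measurable_snd hA, ← lintegral_indicator_one (measurable_snd hA),
    lintegral_pairMeasure, lintegral_prod_symm, ← m.lintegral_intensity_profile hρ A,
    ← lintegral_indicator hA]
  · congr 1
    refine lintegral_congr fun z => ?_
    by_cases hz : z ∈ A
    · rw [indicator_of_mem hz]
      refine lintegral_congr fun w => ?_
      rw [indicator_of_mem (by exact hz), Pi.one_apply, one_mul, norm_mobius_neg_comm]
    · rw [indicator_of_notMem hz]
      refine (lintegral_congr fun w => ?_).trans lintegral_zero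
      rw [indicator_of_notMem (by exact hz), zero_mul]
  · exact ((measurable_one.indicator (measurable_snd hA)).mul
      (m.measurable_profile_mobius ρ)).aemeasurable

instance (m : InvModel) (ρ : ℝ) : SFinite (m.intensity ρ) := by
  unfold intensity; infer_instance

instance (m : InvModel) (ρ : ℝ) : SigmaFinite (m.refMeasure ρ) := by
  unfold refMeasure; exact SigmaFinite.withDensity_ofReal _

lemma intensity_apply (m : InvModel) {ρ : ℝ} (hρ : 0 < ρ) {A : Set ℂ} (hA : MeasurableSet A) :
    m.intensity ρ A = ∫⁻ z in A, ENNReal.ofReal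
      (ρ / Real.pi * (1 / (1 + m.curv * ‖z‖ ^ 2)) ^ 2) ∂(volume.restrict (curvSpace m.curv)) := by
  have hπ := Real.pi_pos
  rw [intensity, Measure.smul_apply, smul_eq_mul, curvArea, withDensity_apply _ hA,
    ← lintegral_const_mul' _ _ ENNReal.ofReal_ne_top]
  refine lintegral_congr fun z => ?_
  rw [← ENNReal.ofReal_mul (by positivity)]

lemma lintegral_kernel_self (m : InvModel) {ρ : ℝ} (hρ : 0 < ρ) {A : Set ℂ}
    (hA : MeasurableSet A) :
    ∫⁻ z in A, ENNReal.ofReal (m.kernel ρ z z).re ∂(m.refMeasure ρ) = m.intensity ρ A := by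
  rw [m.intensity_apply hρ hA, refMeasure, restrict_withDensity hA,
    lintegral_withDensity_eq_lintegral_mul_non_measurable _
      (m.measurable_refDensity ρ).ennreal_ofReal (ae_of_all _ fun _ => ENNReal.ofReal_lt_top),
    space_eq]
  refine lintegral_congr_ae ?_
  filter_upwards [ae_restrict_of_ae (ae_restrict_mem (isOpen_curvSpace m.curv).measurableSet)]
    with z hz
  rw [Pi.mul_apply, ← ENNReal.ofReal_mul (m.refDensity_nonneg hρ hz), ← (m.kernel_self hz).2,
    mul_comm]

/-- The pair correlation identity, in the form `ρ₂ + |K|² = ρ₁ ⊗ ρ₁`. -/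
lemma lintegral_kernel_det (m : InvModel) {ρ : ℝ} (hm : m.Admissible ρ) (hρ : 1 < ρ)
    {A B : Set ℂ} (hA : MeasurableSet A) (hB : MeasurableSet B) :
    ∫⁻ x in A ×ˢ B, ENNReal.ofReal (m.kernel ρ x.1 x.1 * m.kernel ρ x.2 x.2 -
      m.kernel ρ x.1 x.2 * m.kernel ρ x.2 x.1).re ∂((m.refMeasure ρ).prod (m.refMeasure ρ)) +
      m.pairMeasure ρ (A ×ˢ B) = m.intensity ρ A * m.intensity ρ B := by
  have hρ0 : 0 < ρ := by linarith
  have hπ := Real.pi_pos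
  set c := m.curv with hc
  set vol := (volume.restrict (curvSpace c) : Measure ℂ) with hvol
  have hd := (m.measurable_refDensity ρ).ennreal_ofReal
  have hcm := measurable_conformal c
  have hAB := hA.prod hB
  have hdm : Measurable fun x : ℂ × ℂ => ENNReal.ofReal (m.refDensity ρ x.1) *
      ENNReal.ofReal (m.refDensity ρ x.2) :=
    (hd.comp measurable_fst).mul (hd.comp measurable_snd)
  have hcc : Measurable fun x : ℂ × ℂ => ENNReal.ofReal ((1 / (1 + c * ‖x.1‖ ^ 2)) ^ 2) *
      ENNReal.ofReal ((1 / (1 + c * ‖x.2‖ ^ 2)) ^ 2) :=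
    (hcm.comp measurable_fst).mul (hcm.comp measurable_snd)
  have hpm := (m.measurable_profile_mobius ρ).const_mul (ENNReal.ofReal ((ρ / Real.pi) ^ 2))
  have hfin : ∀ a b : ℝ, ENNReal.ofReal a * ENNReal.ofReal b < ∞ := fun a b =>
    ENNReal.mul_lt_top ENNReal.ofReal_lt_top ENNReal.ofReal_lt_top
  have e1 : (m.refMeasure ρ).prod (m.refMeasure ρ) = (vol.prod vol).withDensity fun x =>
      ENNReal.ofReal (m.refDensity ρ x.1) * ENNReal.ofReal (m.refDensity ρ x.2) := by
    rw [refMeasure, space_eq, prod_withDensity hd hd]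
  have e2 : (curvArea c).prod (curvArea c) = (vol.prod vol).withDensity fun x =>
      ENNReal.ofReal ((1 / (1 + c * ‖x.1‖ ^ 2)) ^ 2) *
        ENNReal.ofReal ((1 / (1 + c * ‖x.2‖ ^ 2)) ^ 2) := by
    rw [curvArea, prod_withDensity hcm hcm]
  have e3 : m.intensity ρ A * m.intensity ρ B = ∫⁻ x in A ×ˢ B,
      ENNReal.ofReal (ρ / Real.pi * (1 / (1 + c * ‖x.1‖ ^ 2)) ^ 2) *
        ENNReal.ofReal (ρ / Real.pi * (1 / (1 + c * ‖x.2‖ ^ 2)) ^ 2) ∂(vol.prod vol) := by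
    rw [← Measure.prod_restrict, lintegral_prod_mul
      (f := fun z : ℂ => ENNReal.ofReal (ρ / Real.pi * (1 / (1 + c * ‖z‖ ^ 2)) ^ 2))
      (g := fun z : ℂ => ENNReal.ofReal (ρ / Real.pi * (1 / (1 + c * ‖z‖ ^ 2)) ^ 2))
      (Measurable.aemeasurable (by fun_prop)) (Measurable.aemeasurable (by fun_prop)),
      m.intensity_apply hρ0 hA, m.intensity_apply hρ0 hB]
  rw [e1, e3, pairMeasure, withDensity_apply _ hAB, ← hc, e2, restrict_withDensity hAB,
    restrict_withDensity hAB,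
    lintegral_withDensity_eq_lintegral_mul_non_measurable _ hdm (ae_of_all _ fun _ => hfin _ _),
    lintegral_withDensity_eq_lintegral_mul_non_measurable _ hcc (ae_of_all _ fun _ => hfin _ _),
    ← lintegral_add_right _ (hcc.mul hpm)]
  have hmem : ∀ᵐ z ∂vol, z ∈ curvSpace c := ae_restrict_mem (isOpen_curvSpace c).measurableSet
  have hden : ∀ᵐ x ∂(vol.prod vol), 1 - (c : ℂ) * conj (-x.1) * x.2 ≠ 0 := by
    refine (Measure.ae_prod_iff_ae_ae ?_).2 (ae_of_all _ fun z =>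
      ae_restrict_of_ae (ae_mobius_den_ne_zero c (-z)))
    exact (isOpen_ne_fun (by fun_prop) continuous_const).measurableSet
  refine lintegral_congr_ae (ae_restrict_of_ae ?_)
  filter_upwards [Measure.quasiMeasurePreserving_fst.ae hmem,
    Measure.quasiMeasurePreserving_snd.ae hmem, hden] with x h1 h2 h3
  have hd1 := m.refDensity_nonneg hρ0 h1
  have hd2 := m.refDensity_nonneg hρ0 h2
  have hp : 0 ≤ 1 + c * ‖mobius c (-x.1) x.2‖ ^ 2 :=
    (mem_curvSpace.1 (mobius_mem_curvSpace h3 (neg_mem_curvSpace h1) h2)).le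
  have hp0 := m.profile_nonneg ρ hp
  have hp1 := m.profile_le_one hρ hp
  have hk1 := m.kernel_self (ρ := ρ) h1
  have hk2 := m.kernel_self (ρ := ρ) h2
  have hk := m.kernel_mul_swap hm h1 h2 h3
  rw [← hc] at hk hk1 hk2
  simp only [Pi.mul_apply]
  rw [← ENNReal.ofReal_mul hd1, ← ENNReal.ofReal_mul (by positivity),
    ← ENNReal.ofReal_mul (by positivity), ← ENNReal.ofReal_mul (by positivity),
    ← ENNReal.ofReal_mul (by positivity), ← ENNReal.ofReal_mul (by positivity)]
  -- With respect to `ν ⊗ ν` the two-point intensity is `(ρ/π)² (1 - h)`; adding the density `(ρ/π)²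
  -- h` of the pair measure leaves the product of intensities.
  have key : m.refDensity ρ x.1 * m.refDensity ρ x.2 * (m.kernel ρ x.1 x.1 * m.kernel ρ x.2 x.2 -
      m.kernel ρ x.1 x.2 * m.kernel ρ x.2 x.1).re =
      (ρ / Real.pi) ^ 2 * (1 - m.profile ρ ‖mobius c (-x.1) x.2‖) *
        ((1 / (1 + c * ‖x.1‖ ^ 2)) ^ 2 * (1 / (1 + c * ‖x.2‖ ^ 2)) ^ 2) := by
    rw [Complex.sub_re, Complex.mul_re (m.kernel ρ x.1 x.1), hk1.1, zero_mul, sub_zero]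
    linear_combination (m.kernel ρ x.2 x.2).re * m.refDensity ρ x.2 * hk1.2 +
      ρ / Real.pi * (1 / (1 + c * ‖x.1‖ ^ 2)) ^ 2 * hk2.2 - hk
  rw [key, ← ENNReal.ofReal_add (mul_nonneg (mul_nonneg (by positivity) (sub_nonneg.2 hp1))
    (by positivity)) (by positivity)]
  congr 1
  ring

theorem hasPairLaw (m : InvModel) {ρ : ℝ} (hm : m.Admissible ρ) (hρ : 1 < ρ) {Ω : Type*}
    [MeasurableSpace Ω] {P : Measure Ω} {Z : Ω → Set ℂ}
    (hZ : IsDeterminantal P m.space (m.kernel ρ) (m.refMeasure ρ) Z) :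
    HasPairLaw P Z (m.intensity ρ) (m.pairMeasure ρ) where
  countable := by
    have h := hZ.toIsPointProcess
    rw [space_eq] at h
    exact h.countable m.curv_cases
  measurable_count := hZ.measurable_count
  intensity D hD := by
    have h := hZ.jointIntensity 1 le_rfl (fun _ => D) (fun _ => hD) fun i j hij =>
      (hij (Subsingleton.elim i j)).elim
    simp only [Finset.univ_unique, Finset.prod_singleton, Matrix.det_unique, Matrix.of_apply] at h
    rw [h, ← m.lintegral_kernel_self (by linarith) hD]
    have hp := measurePreserving_funUnique (m.refMeasure ρ) (Fin 1)
    rw [← hp.setLIntegral_comp_preimage_emb (MeasurableEquiv.measurableEmbedding _)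
      (fun z => ENNReal.ofReal (m.kernel ρ z z).re) D]
    congr 2
    ext x
    simp
  pair A B hA hB hAB := by
    have h := hZ.jointIntensity 2 one_le_two ![A, B]
      (by intro i; fin_cases i <;> assumption) (by
        intro i j hij
        fin_cases i <;> fin_cases j
        · exact (hij rfl).elim
        · exact hAB
        · exact hAB.symm
        · exact (hij rfl).elim)
    simp only [Fin.prod_univ_two, Matrix.cons_val_zero, Matrix.cons_val_one,
      Matrix.det_fin_two, Matrix.of_apply] at h
    rw [h, ← m.lintegral_kernel_det hm hρ hA hB]
    congr 1
    have hp := measurePreserving_finTwoArrow (m.refMeasure ρ)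
    rw [← hp.setLIntegral_comp_preimage_emb (MeasurableEquiv.measurableEmbedding _)
      (fun x : ℂ × ℂ => ENNReal.ofReal (m.kernel ρ x.1 x.1 * m.kernel ρ x.2 x.2 -
      m.kernel ρ x.1 x.2 * m.kernel ρ x.2 x.1).re) (A ×ˢ B)]
    congr 2
    ext x
    simp [Fin.forall_fin_two]
  fst_marginal := m.map_fst_pairMeasure (by linarith)
  snd_marginal := m.map_snd_pairMeasure (by linarith)
  diagonal_null := withDensity_absolutelyContinuous _ _
    (prod_diagonal_eq_zero (curvArea_absolutelyContinuous _))
  prod_diagonal_null := prod_diagonal_eq_zero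
    (Measure.smul_absolutelyContinuous.trans (curvArea_absolutelyContinuous _))

/-- The dependence on the density cancels here: `(ρ/π)² · 256π/ρ² = 256/π`. -/
lemma lintegral_sub_sq_pairMeasure_le (m : InvModel) {ρ : ℝ} (hm : m.Admissible ρ) (hρ : 1 < ρ)
    {f : ℂ → ℝ} {g : ℂ → ℂ} (hfg : HasWeakGradientOn (curvSpace m.curv) f g) :
    ∫⁻ x, ‖f x.1 - f x.2‖ₑ ^ 2 ∂(m.pairMeasure ρ) ≤
      ENNReal.ofReal (256 / Real.pi) * ∫⁻ p in curvSpace m.curv, ‖g p‖ₑ ^ 2 := by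
  have hπ := Real.pi_pos
  rw [lintegral_pairMeasure]
  calc _ ≤ ENNReal.ofReal ((ρ / Real.pi) ^ 2) * ((∫⁻ p in curvSpace m.curv, ‖g p‖ₑ ^ 2) *
        ENNReal.ofReal (256 * Real.pi / ρ ^ 2)) := by
        gcongr
        refine (lintegral_sub_sq_le m.curv_cases hfg
          (H := fun r => ENNReal.ofReal (m.profile ρ r)) (m.measurable_profile ρ).ennreal_ofReal
          fun _ => ENNReal.ofReal_ne_top).trans ?_
        gcongr
        exact m.lintegral_radialLength_sq_mul_profile_le hρ hm
    _ = _ := by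
        rw [mul_left_comm, ← ENNReal.ofReal_mul (by positivity), mul_comm]
        congr 2
        have : ρ ≠ 0 := by linarith
        field_simp

lemma lintegral_intrinsicGradSq (m : InvModel) (g : ℂ → ℂ) :
    ∫⁻ z, ENNReal.ofReal (m.intrinsicGradSq g z) ∂m.invMeasure =
      ∫⁻ p in curvSpace m.curv, ‖g p‖ₑ ^ 2 := by
  rw [invMeasure_eq, lintegral_curvArea]
  refine setLIntegral_congr_fun (isOpen_curvSpace _).measurableSet fun z hz => ?_
  have h := mem_curvSpace.1 hz
  rw [intrinsicGradSq, conformalFactor_eq, ← ENNReal.ofReal_mul (by positivity),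
    mul_div_cancel₀ _ (by positivity), ENNReal.ofReal_pow (norm_nonneg _), ofReal_norm]

end InvModel

end

/-! ### The variance bound. -/

theorem mainTheorem4 :
    ∃ c : ℝ, 0 < c ∧
      ∀ (m : InvModel) (ρ : ℝ), m.Admissible ρ → 1 < ρ →
      ∀ {Ω : Type*} [MeasurableSpace Ω] (P : Measure Ω) [IsProbabilityMeasure P]
        (Z : Ω → Set ℂ), IsDeterminantal P m.space (m.kernel ρ) (m.refMeasure ρ) Z →
      ∀ (f : ℂ → ℝ) (g : ℂ → ℂ), Integrable f m.invMeasure →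
        HasWeakGradientOn m.space f g →
        Integrable (m.intrinsicGradSq g) m.invMeasure →
        (∀ᵐ ω ∂P, Summable fun z : Z ω => f z) ∧
        MemLp (linearStatistic Z f) 2 P ∧
        Var[linearStatistic Z f; P] ≤ c * ∫ z, m.intrinsicGradSq g z ∂m.invMeasure := by
  have hc : 0 < 256 / Real.pi := div_pos (by norm_num) Real.pi_pos
  refine ⟨256 / Real.pi, hc, ?_⟩
  intro m ρ hm hρ Ω _ P _ Z hZ f g hf hfg hg
  rw [m.space_eq] at hfg
  have hnn : ∀ z, 0 ≤ m.intrinsicGradSq g z := fun z => by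
    unfold InvModel.intrinsicGradSq; positivity
  have hE := m.lintegral_sub_sq_pairMeasure_le hm hρ hfg
  rw [← m.lintegral_intrinsicGradSq, ← ofReal_integral_eq_lintegral_ofReal hg (ae_of_all _ hnn),
    ← ENNReal.ofReal_mul hc.le] at hE
  have hfi : Integrable f (m.intensity ρ) := by
    rw [m.invMeasure_eq] at hf
    exact hf.smul_measure ENNReal.ofReal_ne_top
  obtain ⟨hs, hL, hV⟩ := (m.hasPairLaw hm hρ hZ).linearStatistic_bound hfi
    (ne_top_of_le_ne_top ENNReal.ofReal_ne_top hE)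
  refine ⟨hs, hL, ?_⟩
  -- The bound is known for the extended variance, which agrees with the real one because the second
  -- moment is finite.
  rw [← ENNReal.ofReal_le_ofReal_iff (mul_nonneg hc.le (integral_nonneg hnn)),
    ofReal_variance hL]
  exact hV.trans hE
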